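/- **Setting.** Parametrize $S^1$ by the angle $t$, let $dt$ have total mass $2\pi$, and let $f_n=(2\pi)^{-1/2}\int_{S^1} f(t)e^{-int}\,dt$ for $f\in C^\infty(S^1,\mathbb R)$. In the vacuum Fock representation of the current algebra $[J_m,J_n]=m\,\delta_{m+n,0}$ put $J(f)=\sum_n f_nJ_n$ and $W(f)=e^{iJ(f)}$, so that $W(f)W(g)=e^{-\frac i2\int fg'\,dt}\,W(f+g)$. The $\mathrm U(1)$-current net assigns to each non-empty, non-dense open interval $J\subset S^1$ the von Neumann algebra $\mathcal A(J)=\{W(f):\operatorname{supp}f\subset J\}''$. For $g\in C^\infty(S^1,\mathbb R)$ let $\sigma_g=\{\sigma_{g,J}\}_J$ be the representation of the net with $\sigma_{g,J}(W(f))=e^{i\int fg\,dt}\,W(f)$ for $\operatorname{supp} f\subset J$; it is implemented on $\mathcal A(J)$ by $\operatorname{Ad}W(H)$ for any smooth $H$ on $S^1$ with $H'=g$ on $J$. Fix an interval $I$ and $h\in C^\infty(S^1,\mathbb R)$ with $\operatorname{supp}h\subset I$ and $\int_{S^1}h\,dt=1$. For $\alpha\in\mathbb R$ write $\sigma_{\alpha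 h}$, with abuse of notation, for the representation $\sigma_{\sqrt{2\pi}\,\alpha h}$, which has charge $\alpha$. **Braiding.** Let $I,I_1,I_2$ be pairwise disjoint intervals contained in an interval $K$; the point at infinity lies outside $K$, and $K$ carries the counterclockwise order. Let $\rho_1,\rho_2$ be representations of the net localized in $I$. For $i=1,2$ choose a representation $\tilde\rho_i$ of the net localized in $I_i$ and a charge transporter $V_i$ from $\rho_i$ to $\tilde\rho_i$, that is, a unitary intertwiner lying in $\mathcal A(J)$ for every interval $J\supset I\cup I_i$. The DHR braiding is $$\epsilon(\rho_1,\rho_2)=\rho_2(V_1^*)\,V_2^*\,V_1\,\rho_1(V_2),$$ with $\rho_1,\rho_2$ evaluated on $\mathcal A(K)$. **Statement.** For every $\alpha\in\mathbb R$ the representation $\sigma_{\alpha h}$ is an automorphism of the net (it maps each $\mathcal A(J)$ onto itself) and is localized in $I$. For all $\alpha_1,\alpha_2\in\mathbb R$ and all $I_1,I_2,K$ as above, choices of $\tilde\rho_i$ and $V_i$ for $\rho_i=\sigma_{\alpha_i h}$ exist, and every such choice gives $$\epsilon(\sigma_{\alpha_1h},\sigma_{\alpha_2h})=e^{i\pi\alpha_1\alpha_2}\,\mathbf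 1\quad\text{if } I_2 \text{ lies before } I_1 \text{ in } K,$$ $$\epsilon(\sigma_{\alpha_1h},\sigma_{\alpha_2h})=e^{-i\pi\alpha_1\alpha_2}\,\mathbf 1\quad\text{if } I_1 \text{ lies before } I_2 \text{ in } K$$ (the second is the opposite braiding). In particular $\epsilon(\sigma_{\alpha_1h},\sigma_{\alpha_2h})=\epsilon(\sigma_{\alpha_2h},\sigma_{\alpha_1h})$ in either configuration. -/

import Mathlib

/-!
The U(1)-current net in its vacuum representation, its charged automorphisms and their DHR braiding.
The circle is parametrized by the angle: functions on the circle are the 2π-periodic functions on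
the line, and subsets of the circle are the 2π-periodic subsets of the line.
-/

namespace U1Current

open Complex (I)
open scoped ContDiff

/-! Preliminaries: an exponential series over multi-indices. -/

theorem sum_aux {ι 𝕜 : Type*} [DecidableEq ι] [RCLike 𝕜] (a : ι → 𝕜) (s : Finset ι) :
    Summable (fun k : {k : ι →₀ ℕ // k.support ⊆ s} =>
      ‖k.1.prod fun n m => a n ^ m / (m.factorial : 𝕜)‖) ∧
    HasSum (fun k : {k : ι →₀ ℕ // k.support ⊆ s} =>
      (k.1.prod fun n m => a n ^ m / (m.factorial : 𝕜))) (∏ n ∈ s, NormedSpace.exp (a n)) := by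
  induction s using Finset.induction_on with
  | empty =>
    have : Unique {k : ι →₀ ℕ // k.support ⊆ (∅ : Finset ι)} :=
      { default := ⟨0, by simp⟩
        uniq := fun k => by ext1; simpa using k.2 }
    have h0 : ∀ k : {k : ι →₀ ℕ // k.support ⊆ (∅ : Finset ι)}, k.1 = 0 := fun k => by
      simpa using k.2
    refine ⟨(hasSum_fintype _).summable, ?_⟩
    simp [h0]
  | insert n s hn ih =>
    let e : ℕ × {k : ι →₀ ℕ // k.support ⊆ s} ≃ {k : ι →₀ ℕ // k.support ⊆ insert n s} :=
      { toFun := fun p => ⟨p.2.1.update n p.1, by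
          intro i hi
          by_cases h : i = n
          · simp [h]
          · refine Finset.mem_insert_of_mem (p.2.2 ?_)
            simpa [Finsupp.update_apply, h] using hi⟩
        invFun := fun k => (k.1 n, ⟨k.1.erase n, by
          intro i hi
          rw [Finsupp.support_erase, Finset.mem_erase] at hi
          exact Finset.mem_of_mem_insert_of_ne (k.2 hi.2) hi.1⟩)
        left_inv := fun p => by
          have h0 : p.2.1 n = 0 := by
            by_contra h
            exact hn (p.2.2 (by simpa using h))
          ext1
          · simp
          · ext i
            by_cases h : i = n
            · subst h; simp [h0]
            · simp [Finsupp.erase_ne h]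
        right_inv := fun k => by
          ext i
          by_cases h : i = n
          · subst h; simp
          · simp }
    have hp : ∀ k : ι →₀ ℕ, ∀ t : Finset ι, k.support ⊆ t →
        (k.prod fun n m => a n ^ m / (m.factorial : 𝕜)) =
          ∏ i ∈ t, a i ^ (k i) / ((k i).factorial : 𝕜) := fun k t ht =>
      Finsupp.prod_of_support_subset _ ht _ (by simp)
    have key : ∀ p : ℕ × {k : ι →₀ ℕ // k.support ⊆ s},
        ((e p).1.prod fun n m => a n ^ m / (m.factorial : 𝕜)) =
        (a n ^ p.1 / (p.1.factorial : 𝕜)) *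
          (p.2.1.prod fun n m => a n ^ m / (m.factorial : 𝕜)) := by
      intro p
      rw [hp _ _ (e p).2, hp _ _ p.2.2, Finset.prod_insert hn]
      congr 1
      · simp [e]
      · refine Finset.prod_congr rfl fun i hi => ?_
        have : i ≠ n := by rintro rfl; exact hn hi
        simp [e, Function.update_of_ne this]
    have h1 := NormedSpace.norm_expSeries_div_summable (a n)
    have h2 := NormedSpace.expSeries_div_hasSum_exp (a n)
    refine ⟨?_, ?_⟩
    · rw [← e.summable_iff]
      simp only [Function.comp_def, key]
      exact Summable.mul_norm (f := fun m : ℕ => a n ^ m / (m.factorial : 𝕜))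
        (g := fun k : {k : ι →₀ ℕ // k.support ⊆ s} =>
          k.1.prod fun n m => a n ^ m / (m.factorial : 𝕜)) h1 ih.1
    · rw [← e.hasSum_iff, Finset.prod_insert hn]
      simp only [Function.comp_def, key]
      exact HasSum.mul (f := fun m : ℕ => a n ^ m / (m.factorial : 𝕜))
        (g := fun k : {k : ι →₀ ℕ // k.support ⊆ s} =>
          k.1.prod fun n m => a n ^ m / (m.factorial : 𝕜)) h2 ih.2
        (summable_mul_of_summable_norm (f := fun m : ℕ => a n ^ m / (m.factorial : 𝕜))
        (g := fun k : {k : ι →₀ ℕ // k.support ⊆ s} =>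
          k.1.prod fun n m => a n ^ m / (m.factorial : 𝕜)) h1 ih.1)

theorem norm_term {ι : Type*} (a : ι → ℂ) (k : ι →₀ ℕ) :
    ‖k.prod fun n m => a n ^ m / (m.factorial : ℂ)‖ =
      k.prod fun n m => ‖a n‖ ^ m / (m.factorial : ℝ) := by
  simp [Finsupp.prod, norm_prod]

theorem summable_term {ι : Type*} (a : ι → ℂ) (ha : Summable fun n => ‖a n‖) :
    Summable (fun k : ι →₀ ℕ => ‖k.prod fun n m => a n ^ m / (m.factorial : ℂ)‖) := by
  classical
  refine summable_of_sum_le (c := Real.exp (∑' n, ‖a n‖)) (fun k => norm_nonneg _) fun F => ?_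
  let s : Finset ι := F.biUnion fun k => k.support
  have hs : ∀ k ∈ F, k.support ⊆ s := fun k hk => Finset.subset_biUnion_of_mem _ hk
  have h := (sum_aux (fun n => ‖a n‖) s)
  have h2 : ∑ k ∈ F, ‖k.prod fun n m => a n ^ m / (m.factorial : ℂ)‖ =
      ∑ k ∈ F.subtype (fun k => k.support ⊆ s),
        k.1.prod fun n m => ‖a n‖ ^ m / (m.factorial : ℝ) := by
    rw [Finset.sum_subtype_of_mem (fun k : ι →₀ ℕ => k.prod fun n m => ‖a n‖ ^ m / (m.factorial : ℝ)) hs]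
    exact Finset.sum_congr rfl fun k _ => norm_term a k
  rw [h2]
  refine (sum_le_hasSum _ (fun k _ => ?_) h.2).trans ?_
  · exact Finset.prod_nonneg fun i _ => by positivity
  · simp only [← Real.exp_eq_exp_ℝ, ← Real.exp_sum]
    exact Real.exp_le_exp.2 (ha.sum_le_tsum _ fun i _ => norm_nonneg _)

theorem hasSum_term {ι : Type*} (a : ι → ℂ) (ha : Summable fun n => ‖a n‖) :
    HasSum (fun k : ι →₀ ℕ => k.prod fun n m => a n ^ m / (m.factorial : ℂ))
      (Complex.exp (∑' n, a n)) := by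
  classical
  have hs := summable_term a ha
  have h1 : Filter.Tendsto (fun s : Finset ι => ∑' k : ι →₀ ℕ,
      Set.indicator {k : ι →₀ ℕ | k.support ⊆ s}
        (fun k => k.prod fun n m => a n ^ m / (m.factorial : ℂ)) k) Filter.atTop
      (nhds (∑' k : ι →₀ ℕ, k.prod fun n m => a n ^ m / (m.factorial : ℂ))) := by
    refine tendsto_tsum_of_dominated_convergence hs (fun k => ?_) (Filter.Eventually.of_forall
      fun s k => norm_indicator_le_norm_self _ _)
    refine tendsto_const_nhds.congr' ?_
    filter_upwards [Filter.eventually_ge_atTop k.support] with s hs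
    rw [Set.indicator_of_mem]
    exact hs
  have h2 : Filter.Tendsto (fun s : Finset ι => Complex.exp (∑ n ∈ s, a n)) Filter.atTop
      (nhds (Complex.exp (∑' n, a n))) :=
    (Complex.continuous_exp.tendsto _).comp ha.of_norm.hasSum
  have h3 : ∀ s : Finset ι, (∑' k : ι →₀ ℕ,
      Set.indicator {k : ι →₀ ℕ | k.support ⊆ s}
        (fun k => k.prod fun n m => a n ^ m / (m.factorial : ℂ)) k) =
        Complex.exp (∑ n ∈ s, a n) := by
    intro s
    rw [← tsum_subtype, Complex.exp_sum, Complex.exp_eq_exp_ℂ]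
    exact (sum_aux a s).2.tsum_eq
  simp only [h3] at h1
  rw [← tendsto_nhds_unique h1 h2]
  exact hs.of_norm.hasSum

/-! The vacuum Fock space and its displacement operators. -/

/-- The one-particle space `ℓ²`, with orthonormal basis `J_{-n} Ω / √n`, `n ≥ 1`. -/
abbrev OneParticle : Type := lp (fun _ : ℕ+ => ℂ) 2

/-- The vacuum Hilbert space of the U(1)-current: the completion of the vacuum Verma module, written in
its orthonormal basis `∏ n, (J_{-n} / √n) ^ (k n) / √((k n)!) Ω`, indexed by the finitely supported
multi-indices `k`. -/
abbrev Fock : Type := lp (fun _ : ℕ+ →₀ ℕ => ℂ) 2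

/-- The coordinates of the exponential vector `exp (∑ n, z n • J_{-n} / √n) Ω`. -/
noncomputable def expFun (z : ℕ+ → ℂ) (k : ℕ+ →₀ ℕ) : ℂ :=
  k.prod fun n m => z n ^ m / (Real.sqrt (m.factorial : ℝ) : ℂ)

theorem conj_expFun_mul (z w : ℕ+ → ℂ) (k : ℕ+ →₀ ℕ) :
    expFun w k * (starRingEnd ℂ) (expFun z k) =
      k.prod fun n m => (w n * (starRingEnd ℂ) (z n)) ^ m / (m.factorial : ℂ) := by
  simp only [expFun, Finsupp.prod, map_prod, ← Finset.prod_mul_distrib]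
  refine Finset.prod_congr rfl fun n _ => ?_
  have h : (Real.sqrt ((k n).factorial : ℝ) : ℂ) * (Real.sqrt ((k n).factorial : ℝ) : ℂ) =
      ((k n).factorial : ℂ) := by
    rw [← Complex.ofReal_mul, Real.mul_self_sqrt (by positivity)]
    simp
  rw [map_div₀, map_pow, Complex.conj_ofReal, div_mul_div_comm, h, mul_pow]

theorem summable_sq (z : OneParticle) : Summable fun n => ‖z n‖ ^ 2 := by
  have := lp.memℓp z
  rw [memℓp_gen_iff (by norm_num)] at this
  simpa using this

theorem memℓp_expFun (z : OneParticle) : Memℓp (expFun z) 2 := by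
  rw [memℓp_gen_iff (by norm_num)]
  have h := summable_term (fun n => z n * (starRingEnd ℂ) (z n)) (by
    simpa [← sq] using summable_sq z)
  simp only [← conj_expFun_mul] at h
  simpa [← sq] using h

/-- The exponential (coherent) vector `exp (∑ n, z n • J_{-n} / √n) Ω`; `expVec 0` is the vacuum `Ω`. -/
noncomputable def expVec (z : OneParticle) : Fock := ⟨expFun z, memℓp_expFun z⟩

theorem inner_expVec (z w : OneParticle) :
    inner ℂ (expVec z) (expVec w) = Complex.exp (inner ℂ z w) := by
  have h1 := lp.hasSum_inner (𝕜 := ℂ) z w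
  have h2 := lp.hasSum_inner (𝕜 := ℂ) (expVec z) (expVec w)
  have h3 := hasSum_term (fun n => w n * (starRingEnd ℂ) (z n)) (by
    simpa [Complex.inner] using h1.summable.norm)
  simp only [← conj_expFun_mul] at h3
  have h4 : ∑' n, w n * (starRingEnd ℂ) (z n) = inner ℂ z w := by
    rw [← h1.tsum_eq]; rfl
  rw [h4] at h3
  exact h2.unique h3

theorem expFun_smul (t : ℂ) (z : ℕ+ → ℂ) (k : ℕ+ →₀ ℕ) :
    expFun (fun n => t * z n) k = t ^ k.degree * expFun z k := by
  simp only [expFun, Finsupp.prod, mul_pow, mul_div_assoc, Finset.prod_mul_distrib]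
  rw [Finset.prod_pow_eq_pow_sum]
  rfl

theorem coeff_zero (b : ℕ → ℂ) (h : ∀ t : ℂ, HasSum (fun n => t ^ n * b n) 0) : b = 0 := by
  let p : FormalMultilinearSeries ℂ ℂ ℂ :=
    fun n => ContinuousMultilinearMap.mkPiRing ℂ (Fin n) (b n)
  have hp : HasFPowerSeriesAt (0 : ℂ → ℂ) p 0 := by
    rw [hasFPowerSeriesAt_iff]
    refine Filter.Eventually.of_forall fun t => ?_
    simpa [p, FormalMultilinearSeries.coeff] using h t
  have := hp.eq_zero
  ext n
  have h2 : p.coeff n = 0 := by rw [this]; rfl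
  simpa [p, FormalMultilinearSeries.coeff] using h2

/-- The exponential vectors are total, so that a bounded operator is determined by its values on
them. -/
theorem dense_expVec : (Submodule.span ℂ (Set.range expVec)).topologicalClosure = ⊤ := by
  classical
  rw [Submodule.topologicalClosure_eq_top_iff, Submodule.eq_bot_iff]
  intro ψ hψ
  rw [Submodule.mem_orthogonal] at hψ
  have hz : ∀ z : OneParticle, HasSum (fun k => expFun z k * ψ k) 0 := by
    intro z
    have h1 := lp.hasSum_inner (𝕜 := ℂ) (expVec (star z)) ψ
    rw [hψ _ (Submodule.subset_span ⟨_, rfl⟩)] at h1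
    have h2 : (fun k => expFun z k * ψ k) = fun k => inner ℂ (expVec (star z) k) (ψ k) := by
      funext k
      show _ = ψ k * (starRingEnd ℂ) (expFun (star z) k)
      rw [mul_comm]
      congr 1
      simp [expFun, Finsupp.prod, map_prod]
    rw [h2]
    exact h1
  ext k₀
  set s := k₀.support
  set N := k₀.degree
  let a : (ℕ+ →₀ ℕ) → ℂ := fun k => ψ k * k.prod fun _ m => ((Real.sqrt (m.factorial : ℝ) : ℂ))⁻¹
  let P : MvPolynomial ℕ+ ℂ := ∑ k ∈ s.finsuppAntidiag N, MvPolynomial.monomial k (a k)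
  have hP : P = 0 := by
    refine MvPolynomial.funext fun x => ?_
    rw [map_zero]
    obtain ⟨z, hzv⟩ : ∃ z : OneParticle, ∀ n, z n = if n ∈ s then x n else 0 := by
      refine ⟨∑ n ∈ s, lp.single 2 n (x n), fun n => ?_⟩
      simp only [lp.coeFn_sum, Finset.sum_apply, lp.single_apply]
      simp [Pi.single_apply]
    have hz' : ∀ t : ℂ, HasSum (fun k : ℕ+ →₀ ℕ => t ^ k.degree * (expFun z k * ψ k)) 0 := by
      intro t
      have := hz (t • z)
      have h2 : (fun k : ℕ+ →₀ ℕ => t ^ k.degree * (expFun z k * ψ k)) =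
          fun k => expFun (t • z : OneParticle) k * ψ k := by
        funext k
        rw [← mul_assoc, ← expFun_smul]
        rfl
      rw [h2]
      exact this
    have hb : ∀ t : ℂ, HasSum (fun n : ℕ => t ^ n *
        ∑' k : {k : ℕ+ →₀ ℕ // k.degree = n}, expFun z k.1 * ψ k.1) 0 := by
      intro t
      have h1 := (Equiv.sigmaFiberEquiv (fun k : ℕ+ →₀ ℕ => k.degree)).hasSum_iff.2 (hz' t)
      have h2 := h1.sigma (g := fun n : ℕ => t ^ n *
        ∑' k : {k : ℕ+ →₀ ℕ // k.degree = n}, expFun z k.1 * ψ k.1) fun n => by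
          have h3 := ((hz z).summable.subtype {k : ℕ+ →₀ ℕ | k.degree = n}).hasSum.mul_left (t ^ n)
          have h4 : ((fun k : ℕ+ →₀ ℕ => t ^ k.degree * (expFun z k * ψ k)) ∘
              Equiv.sigmaFiberEquiv fun k : ℕ+ →₀ ℕ => k.degree) ∘ Sigma.mk n =
              fun k : {k : ℕ+ →₀ ℕ // k.degree = n} => t ^ n * (expFun z k.1 * ψ k.1) := by
            funext k
            show t ^ k.1.degree * (expFun z k.1 * ψ k.1) = _
            rw [k.2]
          exact (congrArg (fun F => HasSum F (t ^ n *
            ∑' k : {k : ℕ+ →₀ ℕ // k.degree = n}, expFun z k.1 * ψ k.1)) h4).mpr h3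
      exact h2
    have hb0 := congrFun (coeff_zero _ hb) N
    rw [Pi.zero_apply] at hb0
    rw [← hb0]
    simp only [P, map_sum, MvPolynomial.eval_monomial]
    have hsub := tsum_subtype {k : ℕ+ →₀ ℕ | k.degree = N} (fun k => expFun z k * ψ k)
    refine Eq.trans ?_ hsub.symm
    rw [tsum_eq_sum (s := s.finsuppAntidiag N)]
    · refine Finset.sum_congr rfl fun k hk => ?_
      rw [Finset.mem_finsuppAntidiag] at hk
      have hd : k.degree = N := by
        rw [← hk.1, Finsupp.degree]
        exact Finset.sum_subset hk.2 (by simp)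
      rw [Set.indicator_of_mem (by exact hd)]
      simp only [a, expFun, Finsupp.prod, div_eq_mul_inv, Finset.prod_mul_distrib]
      have : ∏ n ∈ k.support, z n ^ k n = ∏ n ∈ k.support, x n ^ k n :=
        Finset.prod_congr rfl fun n hn => by rw [hzv, if_pos (hk.2 hn)]
      rw [this]; ring
    · intro k hk
      rw [Finset.mem_finsuppAntidiag] at hk
      by_cases hd : k.degree = N
      · rw [Set.indicator_of_mem (by exact hd)]
        have hns : ¬ k.support ⊆ s := by
          intro h
          refine hk ⟨?_, h⟩
          rw [← hd, Finsupp.degree]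
          exact (Finset.sum_subset h (by simp)).symm
        obtain ⟨n, hn, hns⟩ := Finset.not_subset.1 hns
        have : expFun z k = 0 := by
          have h0 : z n = 0 := by rw [hzv, if_neg hns]
          refine Finset.prod_eq_zero hn ?_
          show (z n) ^ (k n) / _ = 0
          rw [h0, zero_pow (by simpa using hn), zero_div]
        rw [this, zero_mul]
      · exact Set.indicator_of_notMem (s := {k : ℕ+ →₀ ℕ | k.degree = N}) hd _
  have hc := congrArg (MvPolynomial.coeff k₀) hP
  have hk₀ : k₀ ∈ s.finsuppAntidiag N := by
    rw [Finset.mem_finsuppAntidiag]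
    exact ⟨rfl, subset_rfl⟩
  simp only [P, MvPolynomial.coeff_sum, MvPolynomial.coeff_monomial, MvPolynomial.coeff_zero,
    Finset.sum_ite_eq', hk₀, if_true, a, mul_eq_zero] at hc
  rcases hc with hc | hc
  · simpa using hc
  · exfalso
    rw [Finsupp.prod, Finset.prod_eq_zero_iff] at hc
    obtain ⟨n, -, hn⟩ := hc
    rw [inv_eq_zero, Complex.ofReal_eq_zero, Real.sqrt_eq_zero (by positivity)] at hn
    exact Nat.factorial_ne_zero _ (by exact_mod_cast hn)

theorem denseRange_expVec : DenseRange (Finsupp.linearCombination ℂ expVec) := by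
  have := dense_expVec
  rw [← Finsupp.range_linearCombination] at this
  exact (Submodule.dense_iff_topologicalClosure_eq_top).2 this

noncomputable def dispVec (v z : OneParticle) : Fock :=
  Complex.exp (-(‖v‖ : ℂ) ^ 2 / 2 - inner ℂ v z) • expVec (z + v)

theorem inner_dispVec (v z w : OneParticle) :
    inner ℂ (dispVec v z) (dispVec v w) = inner ℂ (expVec z) (expVec w) := by
  have hv : inner ℂ v v = (‖v‖ : ℂ) ^ 2 := inner_self_eq_norm_sq_to_K v
  rw [dispVec, dispVec, inner_smul_left, inner_smul_right, inner_expVec, inner_expVec,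
    ← Complex.exp_conj, ← Complex.exp_add, ← Complex.exp_add]
  congr 1
  simp only [map_sub, map_neg, map_div₀, map_pow, Complex.conj_ofReal, inner_add_left,
    inner_add_right, hv, inner_conj_symm, map_ofNat]
  ring

theorem norm_disp (v : OneParticle) (a : OneParticle →₀ ℂ) :
    ‖Finsupp.linearCombination ℂ (dispVec v) a‖ = ‖Finsupp.linearCombination ℂ expVec a‖ := by
  have h : inner ℂ (Finsupp.linearCombination ℂ (dispVec v) a)
      (Finsupp.linearCombination ℂ (dispVec v) a) =
      inner ℂ (Finsupp.linearCombination ℂ expVec a) (Finsupp.linearCombination ℂ expVec a) := by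
    simp only [Finsupp.linearCombination_apply, Finsupp.sum, sum_inner, inner_sum, inner_smul_left,
      inner_smul_right, inner_dispVec]
  rw [inner_self_eq_norm_sq_to_K, inner_self_eq_norm_sq_to_K] at h
  have h2 : ‖Finsupp.linearCombination ℂ (dispVec v) a‖ ^ 2 =
    ‖Finsupp.linearCombination ℂ expVec a‖ ^ 2 := by exact_mod_cast h
  exact (sq_eq_sq₀ (norm_nonneg _) (norm_nonneg _)).1 h2

/-- The displacement operator `exp (a†(v) - a(v))`. It is the unitary operator with
`displacement v (expVec z) = exp (-‖v‖² / 2 - ⟪v, z⟫) • expVec (z + v)`, see `displacement_expVec`,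
`displacement_mul_neg` and `star_displacement`. -/
noncomputable def displacement (v : OneParticle) : Fock →L[ℂ] Fock :=
  (Finsupp.linearCombination ℂ (dispVec v)).extendOfNorm (Finsupp.linearCombination ℂ expVec)

theorem displacement_lc (v : OneParticle) (a : OneParticle →₀ ℂ) :
    displacement v (Finsupp.linearCombination ℂ expVec a) =
      Finsupp.linearCombination ℂ (dispVec v) a :=
  LinearMap.extendOfNorm_eq denseRange_expVec ⟨1, fun x => by rw [norm_disp, one_mul]⟩ a

theorem displacement_expVec (v z : OneParticle) :
    displacement v (expVec z) =
      Complex.exp (-(‖v‖ : ℂ) ^ 2 / 2 - inner ℂ v z) • expVec (z + v) := by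
  simpa [dispVec] using displacement_lc v (Finsupp.single z 1)

theorem ext_expVec {S T : Fock →L[ℂ] Fock} (h : ∀ z, S (expVec z) = T (expVec z)) : S = T :=
  ContinuousLinearMap.ext_on (Submodule.dense_iff_topologicalClosure_eq_top.2 dense_expVec)
    (by rintro _ ⟨z, rfl⟩; exact h z)

theorem displacement_mul (v w : OneParticle) :
    displacement v * displacement w =
      Complex.exp (-(I * (inner ℂ v w : ℂ).im)) • displacement (v + w) := by
  refine ext_expVec fun z => ?_
  simp only [mul_apply_eq_comp, smul_apply, displacement_expVec,
    map_smul, smul_smul, ← Complex.exp_add]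
  rw [show z + w + v = z + (v + w) by abel]
  congr 2
  have hv : (‖v + w‖ : ℂ) ^ 2 = (‖v‖ : ℂ) ^ 2 + 2 * ((inner ℂ v w : ℂ).re : ℂ) + (‖w‖ : ℂ) ^ 2 := by
    exact_mod_cast norm_add_sq (𝕜 := ℂ) v w
  have hi : inner ℂ v w = ((inner ℂ v w : ℂ).re : ℂ) + ((inner ℂ v w : ℂ).im : ℂ) * I :=
    (Complex.re_add_im _).symm
  rw [hv, inner_add_left, inner_add_right]
  linear_combination -hi

theorem displacement_zero : displacement 0 = 1 := by
  refine ext_expVec fun z => ?_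
  simp [displacement_expVec]

theorem displacement_mul_neg (v : OneParticle) : displacement v * displacement (-v) = 1 := by
  rw [displacement_mul]
  have : (inner ℂ v v : ℂ).im = 0 := by
    have := inner_self_im (𝕜 := ℂ) v
    simpa using this
  rw [inner_neg_right, Complex.neg_im, this]
  simp [displacement_zero]

theorem norm_displacement (v : OneParticle) (x : Fock) : ‖displacement v x‖ = ‖x‖ := by
  refine denseRange_expVec.induction_on (p := fun x => ‖displacement v x‖ = ‖x‖) x
    (isClosed_eq (by fun_prop) (by fun_prop)) fun a => ?_
  rw [displacement_lc, norm_disp]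

theorem star_displacement (v : OneParticle) : star (displacement v) = displacement (-v) := by
  have h : star (displacement v) * displacement v = 1 :=
    (ContinuousLinearMap.norm_map_iff_adjoint_comp_self _).1 (norm_displacement v)
  calc star (displacement v) = star (displacement v) * (displacement v * displacement (-v)) := by
        rw [displacement_mul_neg, mul_one]
    _ = displacement (-v) := by rw [← mul_assoc, h, one_mul]

/-! Test functions, currents and Weyl operators. -/

/-- Smooth real functions on the circle, as smooth 2π-periodic functions of the angle. -/
def smoothPeriodic : Submodule ℝ (ℝ → ℝ) where
  carrier := {f | ContDiff ℝ ∞ f ∧ Function.Periodic f (2 * Real.pi)}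
  add_mem' hf hg := ⟨hf.1.add hg.1, hf.2.add hg.2⟩
  zero_mem' := ⟨contDiff_const, fun _ => rfl⟩
  smul_mem' c _ hf := ⟨contDiff_const.smul hf.1, hf.2.smul c⟩

/-- The test functions: smooth real functions on the circle. -/
abbrev TestFun : Type := smoothPeriodic

theorem TestFun.continuous (f : TestFun) : Continuous f.1 := f.2.1.continuous

theorem TestFun.hasDerivAt (f : TestFun) (t : ℝ) : HasDerivAt f.1 (deriv f.1 t) t :=
  (f.2.1.differentiable (by simp) t).hasDerivAt

/-- The derivative with respect to the angle. -/
noncomputable def TestFun.deriv (f : TestFun) : TestFun :=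
  ⟨_root_.deriv f.1, (contDiff_infty_iff_deriv.1 f.2.1).2, by
    intro t
    have h : (fun x => f.1 (x + 2 * Real.pi)) = f.1 := funext f.2.2
    rw [← deriv_comp_add_const, h]⟩

/-- The Fourier coefficient `f_n = (2π)^(-1/2) ∫ f(t) exp (-i n t) dt`. -/
noncomputable def fourierMode (f : TestFun) (n : ℤ) : ℂ :=
  (Real.sqrt (2 * Real.pi) : ℂ)⁻¹ *
    ∫ t in (0 : ℝ)..(2 * Real.pi), (f.1 t : ℂ) * Complex.exp (-(I * n * t))

theorem fourierMode_eq (f : TestFun) (n : ℤ) : fourierMode f n =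
    (Real.sqrt (2 * Real.pi) : ℂ) * fourierCoeffOn Real.two_pi_pos (fun t => (f.1 t : ℂ)) n := by
  rw [fourierCoeffOn_eq_integral, fourierMode]
  have h : ∀ t : ℝ, fourier (-n) (t : AddCircle (2 * Real.pi - 0)) • (f.1 t : ℂ) =
      (f.1 t : ℂ) * Complex.exp (-(I * n * t)) := by
    intro t
    rw [fourier_coe_apply, smul_eq_mul, mul_comm]
    congr 2
    push_cast
    have : (Real.pi : ℂ) ≠ 0 := by exact_mod_cast Real.pi_ne_zero
    field_simp
    ring
  simp only [h]
  have h2 : (Real.sqrt (2 * Real.pi) : ℂ) ≠ 0 := by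
    exact_mod_cast (Real.sqrt_pos.2 Real.two_pi_pos).ne'
  have h3 : (Real.sqrt (2 * Real.pi) : ℂ) ^ 2 = ((2 * Real.pi : ℝ) : ℂ) := by
    rw [← Complex.ofReal_pow, Real.sq_sqrt Real.two_pi_pos.le]
  rw [Complex.real_smul, sub_zero]
  push_cast at h3 ⊢
  rw [← mul_assoc, ← h3]
  congr 1
  field_simp

theorem fourierMode_add (f g : TestFun) (n : ℤ) :
    fourierMode (f + g) n = fourierMode f n + fourierMode g n := by
  have hf := f.continuous
  have hg := g.continuous
  rw [fourierMode, fourierMode, fourierMode, ← mul_add, ← intervalIntegral.integral_add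
    (Continuous.intervalIntegrable (by fun_prop) _ _)
    (Continuous.intervalIntegrable (by fun_prop) _ _)]
  refine congrArg _ (intervalIntegral.integral_congr fun t _ => ?_)
  simp [add_mul]

theorem fourierMode_smul (c : ℝ) (f : TestFun) (n : ℤ) :
    fourierMode (c • f) n = c * fourierMode f n := by
  have h : ∀ t : ℝ, (((c • f).1 t : ℝ) : ℂ) * Complex.exp (-(I * n * t)) =
      c * ((f.1 t : ℂ) * Complex.exp (-(I * n * t))) := fun t => by simp [mul_assoc]
  rw [fourierMode, fourierMode]
  simp only [h, intervalIntegral.integral_const_mul]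
  ring

theorem fourierMode_neg (f : TestFun) (n : ℤ) :
    fourierMode f (-n) = (starRingEnd ℂ) (fourierMode f n) := by
  rw [fourierMode, fourierMode, map_mul, map_inv₀, Complex.conj_ofReal,
    ← intervalIntegral.intervalIntegral_conj]
  refine congrArg _ (intervalIntegral.integral_congr fun t _ => ?_)
  simp [← Complex.exp_conj]

theorem fourierMode_deriv (f : TestFun) (n : ℤ) :
    fourierMode f.deriv n = I * n * fourierMode f n := by
  rcases eq_or_ne n 0 with rfl | hn
  · have : (∫ t in (0 : ℝ)..(2 * Real.pi), ((deriv f.1 t : ℝ) : ℂ)) = 0 := by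
      have h0 := f.2.2 0
      simp only [zero_add] at h0
      rw [intervalIntegral.integral_ofReal, intervalIntegral.integral_eq_sub_of_hasDerivAt
        (fun t _ => f.hasDerivAt t) (f.deriv.continuous.intervalIntegrable _ _), h0, sub_self,
        Complex.ofReal_zero]
    simp [fourierMode, TestFun.deriv, this]
  · have h := fourierCoeffOn_of_hasDerivAt Real.two_pi_pos (f := fun t => (f.1 t : ℂ))
      (f' := fun t => ((deriv f.1 t : ℝ) : ℂ)) hn
      (fun t _ => (f.hasDerivAt t).ofReal_comp)
      (Continuous.intervalIntegrable (by have := f.deriv.continuous; exact Complex.continuous_ofReal.comp this) _ _)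
    have h0 := f.2.2 0
    simp only [zero_add] at h0
    rw [fourierMode_eq, fourierMode_eq]
    rw [h0, sub_self, mul_zero, zero_sub] at h
    have hpi : (Real.pi : ℂ) ≠ 0 := by exact_mod_cast Real.pi_ne_zero
    have hn' : (n : ℂ) ≠ 0 := by exact_mod_cast hn
    rw [h]
    simp only [TestFun.deriv]
    push_cast
    field_simp
    ring

theorem memLp_test (f : TestFun) : MeasureTheory.MemLp (fun t => (f.1 t : ℂ)) 2
    (MeasureTheory.volume.restrict (Set.Ioc 0 (2 * Real.pi))) := by
  have hf : Continuous (fun t => (f.1 t : ℂ)) := Complex.continuous_ofReal.comp f.continuous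
  obtain ⟨C, hC⟩ := isCompact_Icc.exists_bound_of_continuousOn
    (hf.continuousOn (s := Set.Icc 0 (2 * Real.pi)))
  refine MeasureTheory.MemLp.of_bound hf.aestronglyMeasurable C ?_
  filter_upwards [MeasureTheory.ae_restrict_mem measurableSet_Ioc] with t ht
  exact hC t (Set.Ioc_subset_Icc_self ht)

theorem parseval (f : TestFun) :
    HasSum (fun n : ℤ => ‖fourierMode f n‖ ^ 2) (∫ t in (0 : ℝ)..(2 * Real.pi), f.1 t ^ 2) := by
  have h := (hasSum_sq_fourierCoeffOn Real.two_pi_pos (memLp_test f)).mul_left (2 * Real.pi)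
  have h2 : ∀ n : ℤ, ‖fourierMode f n‖ ^ 2 = 2 * Real.pi *
      ‖fourierCoeffOn Real.two_pi_pos (fun t => (f.1 t : ℂ)) n‖ ^ 2 := by
    intro n
    rw [fourierMode_eq, norm_mul, mul_pow, Complex.norm_real, Real.norm_eq_abs, sq_abs,
      Real.sq_sqrt Real.two_pi_pos.le]
  simp only [← h2] at h
  have := Real.pi_ne_zero
  have h4 : 2 * Real.pi * ((2 * Real.pi - 0)⁻¹ • ∫ t in (0 : ℝ)..(2 * Real.pi), ‖(f.1 t : ℂ)‖ ^ 2) =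
      ∫ t in (0 : ℝ)..(2 * Real.pi), f.1 t ^ 2 := by
    rw [sub_zero, smul_eq_mul, mul_inv_cancel_left₀ Real.two_pi_pos.ne']
    simp
  rw [← h4]
  exact h

theorem parseval_inner (f g : TestFun) :
    HasSum (fun n : ℤ => (inner ℂ (fourierMode f n) (fourierMode g n)).re)
      (∫ t in (0 : ℝ)..(2 * Real.pi), f.1 t * g.1 t) := by
  have h := (((parseval (f + g)).sub (parseval f)).sub (parseval g)).mul_left (1 / 2)
  have hf := f.continuous
  have hg := g.continuous
  have e1 : (fun n : ℤ => (inner ℂ (fourierMode f n) (fourierMode g n)).re) = fun n : ℤ =>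
      1 / 2 * (‖fourierMode (f + g) n‖ ^ 2 - ‖fourierMode f n‖ ^ 2 - ‖fourierMode g n‖ ^ 2) := by
    funext n
    rw [fourierMode_add]
    have := norm_add_sq (𝕜 := ℂ) (fourierMode f n) (fourierMode g n)
    simp only [RCLike.re_to_complex] at this
    linarith
  rw [e1]
  refine (congrArg (HasSum _) ?_).mpr h
  · rw [← intervalIntegral.integral_sub, ← intervalIntegral.integral_sub,
      ← intervalIntegral.integral_const_mul]
    · congr 1
      funext t
      show _ = 1 / 2 * ((f.1 t + g.1 t) ^ 2 - _ - _)
      ring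
    all_goals
      refine Continuous.intervalIntegrable ?_ _ _
      fun_prop

theorem memℓp_oneParticle (f : TestFun) :
    Memℓp (fun n : ℕ+ => (Real.sqrt n : ℂ) * fourierMode f (-(n : ℤ))) 2 := by
  rw [memℓp_gen_iff (by norm_num)]
  have hinj : Function.Injective (fun n : ℕ+ => -((n : ℕ) : ℤ)) := by
    intro a b h
    simpa using h
  have h := ((parseval f).summable.add (parseval f.deriv).summable).comp_injective hinj
  refine Summable.of_nonneg_of_le (fun n => by positivity) (fun n => ?_) h
  have hn : (1 : ℝ) ≤ (n : ℕ) := by exact_mod_cast n.2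
  simp only [Function.comp, fourierMode_deriv, norm_mul, mul_pow, Complex.norm_real,
    Real.norm_eq_abs, sq_abs, ENNReal.toReal_ofNat, Real.rpow_ofNat]
  rw [Real.sq_sqrt (by positivity)]
  have h0 := sq_nonneg ‖fourierMode f (-(n : ℤ))‖
  simp only [Complex.norm_I, Int.cast_neg, Int.cast_natCast, norm_neg, Complex.norm_natCast]
  have h1 : ((n : ℕ) : ℝ) ≤ ((n : ℕ) : ℝ) ^ 2 := by nlinarith
  have h2 := mul_le_mul_of_nonneg_right h1 h0
  linarith

/-- The one-particle vector `J(f) Ω = ∑ n ≥ 1, f_{-n} J_{-n} Ω` of the test function `f`. -/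
noncomputable def oneParticle (f : TestFun) : OneParticle := ⟨_, memℓp_oneParticle f⟩

theorem oneParticle_apply (f : TestFun) (n : ℕ+) :
    oneParticle f n = (Real.sqrt n : ℂ) * fourierMode f (-(n : ℤ)) := rfl

theorem oneParticle_add (f g : TestFun) :
    oneParticle (f + g) = oneParticle f + oneParticle g := by
  ext n
  show oneParticle (f + g) n = oneParticle f n + oneParticle g n
  simp only [oneParticle_apply, fourierMode_add, mul_add]

theorem oneParticle_smul (c : ℝ) (f : TestFun) :
    oneParticle (c • f) = (c : ℂ) • oneParticle f := by
  ext n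
  show oneParticle (c • f) n = (c : ℂ) * oneParticle f n
  simp only [oneParticle_apply, fourierMode_smul]
  ring

/-- The symplectic form, `2 Im ⟪J(f) Ω, J(g) Ω⟫ = ∫ f g'`. -/
theorem im_inner_oneParticle (f g : TestFun) :
    (inner ℂ (oneParticle f) (oneParticle g) : ℂ).im =
      (1 / 2) * ∫ t in (0 : ℝ)..(2 * Real.pi), f.1 t * deriv g.1 t := by
  have h1 := (Complex.hasSum_im (lp.hasSum_inner (𝕜 := ℂ) (oneParticle f) (oneParticle g)))
  have h2 := parseval_inner f g.deriv
  set s : ℤ → ℝ := fun n => (inner ℂ (fourierMode f n) (fourierMode g.deriv n)).re with hs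
  have hs' : ∀ n, s n = -n * (inner ℂ (fourierMode f n) (fourierMode g n)).im := by
    intro n
    simp only [hs, fourierMode_deriv, RCLike.inner_apply]
    simp
    ring
  have heven : ∀ n, s (-n) = s n := by
    intro n
    simp only [hs', fourierMode_neg, RCLike.inner_apply]
    simp
    ring
  have h3 := h2.nat_add_neg
  have h4 : ∀ n : ℕ+, s n = (inner ℂ (oneParticle f n) (oneParticle g n)).im := by
    intro n
    rw [oneParticle_apply, oneParticle_apply, ← heven, hs']
    have hsq : Real.sqrt (n : ℕ) * Real.sqrt (n : ℕ) = (n : ℕ) := Real.mul_self_sqrt (by positivity)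
    simp only [RCLike.inner_apply, map_mul, Complex.conj_ofReal]
    rw [show ∀ x a b : ℂ, x * a * (x * b) = (x * x) * (a * b) by intros; ring,
      ← Complex.ofReal_mul, hsq, Complex.im_ofReal_mul]
    simp
  have h0 : s 0 = 0 := by simp [hs']
  simp only [heven, h0, ← two_mul, add_zero] at h3
  have h5 : HasSum (fun n : ℕ+ => 2 * s n) (∫ t in (0 : ℝ)..(2 * Real.pi), f.1 t * g.deriv.1 t) := by
    have := (Function.Injective.hasSum_iff (g := fun n : ℕ+ => (n : ℕ)) PNat.coe_injective
      (f := fun n : ℕ => 2 * s n) (by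
        intro n hn
        have : n = 0 := by
          by_contra h
          exact hn ⟨⟨n, Nat.pos_of_ne_zero h⟩, rfl⟩
        simp [this, h0])).2 h3
    exact this
  have h6 : HasSum (fun n : ℕ+ => s n) (inner ℂ (oneParticle f) (oneParticle g) : ℂ).im := by
    simp only [h4]
    exact h1
  have := (h6.mul_left 2).unique h5
  have h7 : ∀ t, g.deriv.1 t = deriv g.1 t := fun _ => rfl
  simp only [h7] at this
  linarith

/-- The Weyl operator `W(f) = exp (i J(f))`, where `J(f) = ∑ n, f_n J_n`. See `hasDerivAt_weyl` for the
relation with the current and `weyl_mul` for the Weyl relations. -/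
noncomputable def weyl (f : TestFun) : Fock →L[ℂ] Fock := displacement (I • oneParticle f)

theorem oneParticle_zero : oneParticle 0 = 0 := by
  have := oneParticle_smul 0 0
  simpa using this

theorem oneParticle_neg (f : TestFun) : oneParticle (-f) = -oneParticle f := by
  have := oneParticle_smul (-1) f
  rw [show ((-1 : ℝ) • f : TestFun) = -f from neg_one_smul ℝ f] at this
  simpa using this

theorem star_weyl (f : TestFun) : star (weyl f) = weyl (-f) := by
  rw [weyl, star_displacement, weyl, oneParticle_neg, smul_neg]

theorem weyl_mul_weyl_neg (f : TestFun) : weyl f * weyl (-f) = 1 := by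
  rw [weyl, weyl, oneParticle_neg, smul_neg, displacement_mul_neg]

theorem star_weyl_mul (f : TestFun) : star (weyl f) * weyl f = 1 := by
  have := weyl_mul_weyl_neg (-f)
  rw [neg_neg] at this
  rw [star_weyl, this]

theorem weyl_mul_star (f : TestFun) : weyl f * star (weyl f) = 1 := by
  rw [star_weyl, weyl_mul_weyl_neg]

theorem weyl_mul (f g : TestFun) :
    weyl f * weyl g = Complex.exp (-(I / 2 * ((∫ t in (0 : ℝ)..(2 * Real.pi),
      f.1 t * deriv g.1 t : ℝ) : ℂ))) • weyl (f + g) := by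
  rw [weyl, weyl, displacement_mul, weyl, oneParticle_add, smul_add]
  congr 2
  have : inner ℂ (I • oneParticle f) (I • oneParticle g) =
      inner ℂ (oneParticle f) (oneParticle g) := by
    rw [inner_smul_left, inner_smul_right, ← mul_assoc]
    simp
  rw [this, im_inner_oneParticle]
  push_cast
  ring

theorem integral_antisymm (f g : TestFun) :
    ∫ t in (0 : ℝ)..(2 * Real.pi), f.1 t * deriv g.1 t =
      -∫ t in (0 : ℝ)..(2 * Real.pi), g.1 t * deriv f.1 t := by
  have h1 := im_inner_oneParticle f g
  have h2 := im_inner_oneParticle g f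
  have h3 : (inner ℂ (oneParticle f) (oneParticle g) : ℂ).im =
      -(inner ℂ (oneParticle g) (oneParticle f) : ℂ).im := by
    rw [← inner_conj_symm, Complex.conj_im]
  linarith

theorem weyl_conj (H f : TestFun) :
    weyl H * weyl f * star (weyl H) = Complex.exp (I * ((∫ t in (0 : ℝ)..(2 * Real.pi),
      f.1 t * deriv H.1 t : ℝ) : ℂ)) • weyl f := by
  have h : weyl H * weyl f = Complex.exp (I * ((∫ t in (0 : ℝ)..(2 * Real.pi),
      f.1 t * deriv H.1 t : ℝ) : ℂ)) • (weyl f * weyl H) := by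
    rw [weyl_mul, weyl_mul, smul_smul, ← Complex.exp_add, add_comm f H, integral_antisymm H f]
    congr 2
    push_cast
    ring
  rw [h, smul_mul_assoc, mul_assoc, weyl_mul_star, mul_one]

/-- The current mode `J_n`, `n ≥ 1`, on coordinates of vectors. -/
noncomputable def annihilate (n : ℕ+) (ψ : (ℕ+ →₀ ℕ) → ℂ) (k : ℕ+ →₀ ℕ) : ℂ :=
  (Real.sqrt (n * (k n + 1)) : ℂ) * ψ (k + Finsupp.single n 1)

/-- The current mode `J_{-n}`, `n ≥ 1`, on coordinates of vectors. -/
noncomputable def create (n : ℕ+) (ψ : (ℕ+ →₀ ℕ) → ℂ) (k : ℕ+ →₀ ℕ) : ℂ :=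
  (Real.sqrt (n * k n) : ℂ) * ψ (k - Finsupp.single n 1)

/-- The smeared current `J(f) = ∑ n, f_n J_n` on coordinates of vectors. Here `J_0 = 0`, as this is the
vacuum representation. -/
noncomputable def current (f : TestFun) (ψ : (ℕ+ →₀ ℕ) → ℂ) (k : ℕ+ →₀ ℕ) : ℂ :=
  ∑' n : ℕ+, (fourierMode f n * annihilate n ψ k + fourierMode f (-(n : ℤ)) * create n ψ k)

theorem expFun_add_single (z : ℕ+ → ℂ) (k : ℕ+ →₀ ℕ) (n : ℕ+) :
    (Real.sqrt (k n + 1) : ℂ) * expFun z (k + Finsupp.single n 1) = z n * expFun z k := by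
  classical
  have hp : ∀ k : ℕ+ →₀ ℕ, ∀ t : Finset ℕ+, k.support ⊆ t →
      expFun z k = ∏ i ∈ t, z i ^ (k i) / (Real.sqrt ((k i).factorial : ℝ) : ℂ) := fun k t ht =>
    Finsupp.prod_of_support_subset _ ht _ (by simp)
  have hs : (k + Finsupp.single n 1).support ⊆ insert n k.support := by
    intro i hi
    by_cases h : i = n
    · simp [h]
    · simp [Ne.symm h] at hi
      simp [hi]
  rw [hp _ _ hs, hp k _ (Finset.subset_insert n _), ← Finset.mul_prod_erase _ _ (Finset.mem_insert_self _ _),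
    ← Finset.mul_prod_erase _ (fun i => z i ^ (k i) / (Real.sqrt ((k i).factorial : ℝ) : ℂ))
      (Finset.mem_insert_self _ _)]
  have h1 : ∏ i ∈ (insert n k.support).erase n, z i ^ ((k + Finsupp.single n 1 : ℕ+ →₀ ℕ) i) /
      (Real.sqrt (((k + Finsupp.single n 1 : ℕ+ →₀ ℕ) i).factorial : ℝ) : ℂ) =
      ∏ i ∈ (insert n k.support).erase n, z i ^ (k i) / (Real.sqrt ((k i).factorial : ℝ) : ℂ) := by
    refine Finset.prod_congr rfl fun i hi => ?_
    have : i ≠ n := (Finset.mem_erase.1 hi).1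
    simp [this.symm]
  rw [h1, ← mul_assoc, ← mul_assoc]
  congr 1
  have h2 : (Real.sqrt (k n + 1) : ℂ) ≠ 0 := by
    exact_mod_cast (Real.sqrt_pos.2 (by positivity)).ne'
  have h3 : (Real.sqrt ((k n).factorial : ℝ) : ℂ) ≠ 0 := by
    exact_mod_cast (Real.sqrt_pos.2 (by positivity)).ne'
  simp only [Finsupp.add_apply, Finsupp.single_eq_same, Nat.factorial_succ, Nat.cast_mul,
    Nat.cast_succ]
  rw [Real.sqrt_mul (by positivity)]
  push_cast
  field_simp
  ring

theorem annihilate_expFun (z : ℕ+ → ℂ) (k : ℕ+ →₀ ℕ) (n : ℕ+) :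
    annihilate n (expFun z) k = (Real.sqrt n : ℂ) * z n * expFun z k := by
  rw [annihilate, Real.sqrt_mul (by positivity), mul_assoc, ← expFun_add_single]
  push_cast
  ring

theorem create_expFun (z : ℕ+ → ℂ) (k : ℕ+ →₀ ℕ) (n : ℕ+) (hn : n ∈ k.support) :
    create n (expFun z) k = (Real.sqrt n : ℂ) * ((∏ i ∈ k.support.erase n,
      z i ^ (k i) / (Real.sqrt ((k i).factorial : ℝ) : ℂ)) *
        ((k n : ℂ) * z n ^ (k n - 1) / (Real.sqrt ((k n).factorial : ℝ) : ℂ))) := by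
  classical
  have hkn : k n ≠ 0 := by simpa using hn
  have hs : (k - Finsupp.single n 1).support ⊆ k.support := by
    intro i hi
    simp only [Finsupp.mem_support_iff, Finsupp.tsub_apply] at hi ⊢
    omega
  have he : expFun z (k - Finsupp.single n 1) = ∏ i ∈ k.support,
      z i ^ ((k - Finsupp.single n 1 : ℕ+ →₀ ℕ) i) /
        (Real.sqrt (((k - Finsupp.single n 1 : ℕ+ →₀ ℕ) i).factorial : ℝ) : ℂ) :=
    Finsupp.prod_of_support_subset _ hs _ (by simp)
  have h1 : ∏ i ∈ k.support.erase n, z i ^ ((k - Finsupp.single n 1 : ℕ+ →₀ ℕ) i) /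
      (Real.sqrt (((k - Finsupp.single n 1 : ℕ+ →₀ ℕ) i).factorial : ℝ) : ℂ) =
      ∏ i ∈ k.support.erase n, z i ^ (k i) / (Real.sqrt ((k i).factorial : ℝ) : ℂ) := by
    refine Finset.prod_congr rfl fun i hi => ?_
    have : i ≠ n := (Finset.mem_erase.1 hi).1
    simp [this.symm]
  rw [create, he, ← Finset.mul_prod_erase _ _ hn, h1, Real.sqrt_mul (by positivity)]
  obtain ⟨m, hm⟩ := Nat.exists_eq_succ_of_ne_zero hkn
  simp only [Finsupp.tsub_apply, Finsupp.single_eq_same, hm, Nat.succ_eq_add_one,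
    Nat.add_sub_cancel, Nat.factorial_succ, Nat.cast_mul]
  rw [Real.sqrt_mul (by positivity)]
  have h2 : (Real.sqrt ((m + 1 : ℕ) : ℝ) : ℂ) ≠ 0 := by
    exact_mod_cast (Real.sqrt_pos.2 (by positivity)).ne'
  have h3 : (Real.sqrt (m.factorial : ℝ) : ℂ) ≠ 0 := by
    exact_mod_cast (Real.sqrt_pos.2 (by positivity)).ne'
  have h4 : ((m + 1 : ℕ) : ℂ) = (Real.sqrt ((m + 1 : ℕ) : ℝ) : ℂ) ^ 2 := by
    rw [← Complex.ofReal_pow, Real.sq_sqrt (by positivity)]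
    simp
  rw [h4]
  push_cast at h2 h3 ⊢
  field_simp

/-- The generator of the one-parameter group `t ↦ W(t f)` acts on exponential vectors as `i J(f)`
(stated for each coordinate). -/
theorem hasDerivAt_weyl (f : TestFun) (z : OneParticle) (k : ℕ+ →₀ ℕ) :
    HasDerivAt (fun t : ℝ => (weyl (t • f) (expVec z) : Fock) k)
      (I * current f (expVec z) k) 0 := by
  classical
  set u := oneParticle f with hu
  have hW : ∀ t : ℝ, (weyl (t • f) (expVec z) : Fock) k =
      Complex.exp (-((t : ℂ) ^ 2 * (‖u‖ : ℂ) ^ 2) / 2 + t * (I * inner ℂ u z)) *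
        ∏ n ∈ k.support, (z n + t * (I * u n)) ^ (k n) / (Real.sqrt ((k n).factorial : ℝ) : ℂ) := by
    intro t
    rw [weyl, displacement_expVec, oneParticle_smul, ← hu]
    have h1 : (‖I • (t : ℂ) • u‖ : ℂ) ^ 2 = (t : ℂ) ^ 2 * (‖u‖ : ℂ) ^ 2 := by
      rw [norm_smul, norm_smul, Complex.norm_I, one_mul, Complex.norm_real, Real.norm_eq_abs]
      push_cast
      rw [mul_pow, ← Complex.ofReal_pow, sq_abs, Complex.ofReal_pow]
    rw [h1, inner_smul_left, inner_smul_left, Complex.conj_I, Complex.conj_ofReal]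
    show Complex.exp _ * expFun _ k = _
    congr 1
    · congr 1
      ring
    · refine Finset.prod_congr rfl fun n _ => ?_
      show (z n + I * (t * u n)) ^ (k n) / _ = _
      congr 2
      ring
  simp only [hW]
  have hE : HasDerivAt (fun t : ℝ => Complex.exp (-((t : ℂ) ^ 2 * (‖u‖ : ℂ) ^ 2) / 2 +
      t * (I * inner ℂ u z))) (I * inner ℂ u z) 0 := by
    have ht : HasDerivAt (fun t : ℝ => (t : ℂ)) 1 0 := HasDerivAt.ofReal_comp (hasDerivAt_id 0)
    have := ((((ht.pow 2).mul_const ((‖u‖ : ℂ) ^ 2)).neg.div_const 2).add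
      (ht.mul_const (I * inner ℂ u z))).cexp
    simpa using this
  have hP : HasDerivAt (fun t : ℝ => ∏ n ∈ k.support,
      (z n + t * (I * u n)) ^ (k n) / (Real.sqrt ((k n).factorial : ℝ) : ℂ))
      (∑ n ∈ k.support, (∏ i ∈ k.support.erase n,
        z i ^ (k i) / (Real.sqrt ((k i).factorial : ℝ) : ℂ)) *
        ((k n : ℂ) * z n ^ (k n - 1) * (I * u n) / (Real.sqrt ((k n).factorial : ℝ) : ℂ))) 0 := by
    have ht : HasDerivAt (fun t : ℝ => (t : ℂ)) 1 0 := HasDerivAt.ofReal_comp (hasDerivAt_id 0)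
    have := HasDerivAt.fun_finsetProd (u := k.support) (f := fun n (t : ℝ) =>
      (z n + t * (I * u n)) ^ (k n) / (Real.sqrt ((k n).factorial : ℝ) : ℂ)) (x := (0 : ℝ))
      (f' := fun n => (k n : ℂ) * z n ^ (k n - 1) * (I * u n) /
        (Real.sqrt ((k n).factorial : ℝ) : ℂ)) fun n _ => by
          have h := (((ht.mul_const (I * u n)).const_add (z n)).fun_pow (k n)).div_const
            (Real.sqrt ((k n).factorial : ℝ) : ℂ)
          simpa using h
    simpa using this
  have h := hE.mul hP
  refine HasDerivAt.congr_deriv h (Eq.symm ?_)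
  have hsum : HasSum (fun n : ℕ+ => fourierMode f n * annihilate n (expVec z) k)
      (inner ℂ u z * expFun z k) := by
    have := (lp.hasSum_inner (𝕜 := ℂ) u z).mul_right (expFun z k)
    refine (congrArg (fun F => HasSum F _) (funext fun n => ?_)).mp this
    show _ = fourierMode f n * annihilate n (expFun z) k
    rw [annihilate_expFun, RCLike.inner_apply, hu, oneParticle_apply, map_mul, Complex.conj_ofReal,
      ← fourierMode_neg, neg_neg]
    ring
  have hsum2 : HasSum (fun n : ℕ+ => fourierMode f (-(n : ℤ)) * create n (expVec z) k)
      (∑ n ∈ k.support, fourierMode f (-(n : ℤ)) * create n (expVec z) k) := by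
    refine hasSum_sum_of_ne_finset_zero fun n hn => ?_
    have : k n = 0 := by simpa using hn
    simp [create, this]
  have hcur : current f (expVec z) k = _ := (hsum.add hsum2).tsum_eq
  rw [hcur, mul_add, Finset.mul_sum]
  have h0 : ∏ n ∈ k.support, (z n + ((0 : ℝ) : ℂ) * (I * u n)) ^ (k n) /
      (Real.sqrt ((k n).factorial : ℝ) : ℂ) = expFun z k := by
    simp [expFun, Finsupp.prod]
  rw [h0]
  congr 1
  · ring
  · simp only [Complex.ofReal_zero]
    rw [show Complex.exp (-((0 : ℂ) ^ 2 * (‖u‖ : ℂ) ^ 2) / 2 + 0 * (I * inner ℂ u z)) = 1 by simp,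
      one_mul]
    refine Finset.sum_congr rfl fun n hn => ?_
    have := create_expFun z k n hn
    show I * (_ * create n (expFun z) k) = _
    rw [this, hu, oneParticle_apply]
    ring

/-! Intervals, local algebras, representations of the net. -/

/-- A non-empty non-dense open interval of the circle: the angles strictly between `a` and `b`, in the
counterclockwise direction. -/
structure Arc where
  a : ℝ
  b : ℝ
  a_lt_b : a < b
  b_lt : b < a + 2 * Real.pi

/-- The interval as a set of angles, all lifts to the line included. -/
def Arc.carrier (J : Arc) : Set ℝ := {t | ∃ k : ℤ, t + k * (2 * Real.pi) ∈ Set.Ioo J.a J.b}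

/-- The interior of the complement of an interval. -/
noncomputable def Arc.compl (J : Arc) : Arc where
  a := J.b
  b := J.a + 2 * Real.pi
  a_lt_b := J.b_lt
  b_lt := by linarith [J.a_lt_b]

/-- The support of `f` is contained in the interval `J`. -/
def SuppIn (f : TestFun) (J : Arc) : Prop := tsupport f.1 ⊆ J.carrier

theorem exists_primitive (h : TestFun) (J : Arc) :
    ∃ H : TestFun, ∀ t ∈ J.carrier, deriv H.1 t = h.1 t := by
  set m : ℝ := (J.b + (J.a + 2 * Real.pi)) / 2 with hm
  set δ : ℝ := ((J.a + 2 * Real.pi) - J.b) / 2 with hδ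
  have hJ1 := J.a_lt_b
  have hJ2 := J.b_lt
  have hpi := Real.pi_pos
  have hδ0 : 0 < δ := by rw [hδ]; linarith
  have hδ1 : δ < Real.pi := by rw [hδ]; linarith
  let β : ℝ → ℝ := fun t => Real.smoothTransition (Real.cos (t - m) - Real.cos δ)
  have hβs : ContDiff ℝ ∞ β :=
    Real.smoothTransition.contDiff.comp ((Real.contDiff_cos.comp (contDiff_id.sub contDiff_const)).sub contDiff_const)
  have hβp : Function.Periodic β (2 * Real.pi) := by
    intro t
    simp only [β]
    rw [add_sub_right_comm, Real.cos_add_two_pi]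
  have hβ0 : ∀ t ∈ J.carrier, β t = 0 := by
    rintro t ⟨k, hk1, hk2⟩
    refine Real.smoothTransition.zero_of_nonpos (sub_nonpos.2 ?_)
    have hc : Real.cos (t - m) = Real.cos (m - (t + k * (2 * Real.pi))) := by
      rw [← Real.cos_neg, show -(t - m) = m - (t + k * (2 * Real.pi)) + k * (2 * Real.pi) by ring,
        Real.cos_add_int_mul_two_pi]
    rw [hc]
    set x := m - (t + k * (2 * Real.pi))
    have hx1 : δ < x := by simp only [x, hm, hδ]; linarith
    have hx2 : x < 2 * Real.pi - δ := by simp only [x, hm, hδ]; linarith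
    rcases le_total x Real.pi with hx | hx
    · exact Real.cos_le_cos_of_nonneg_of_le_pi hδ0.le hx hx1.le
    · rw [← Real.cos_two_pi_sub]
      exact Real.cos_le_cos_of_nonneg_of_le_pi hδ0.le (by linarith) (by linarith)
  have hβi : 0 < ∫ t in (0 : ℝ)..(2 * Real.pi), β t := by
    refine intervalIntegral.integral_pos Real.two_pi_pos hβs.continuous.continuousOn
      (fun t _ => Real.smoothTransition.nonneg _) ?_
    obtain ⟨y, hy, hyx⟩ := hβp.exists_mem_Ico₀ Real.two_pi_pos m
    refine ⟨y, Set.Ico_subset_Icc_self hy, ?_⟩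
    rw [← hyx]
    refine Real.smoothTransition.pos_of_pos ?_
    rw [sub_self, Real.cos_zero, sub_pos]
    have := Real.cos_lt_cos_of_nonneg_of_le_pi le_rfl hδ1.le hδ0
    rwa [Real.cos_zero] at this
  set c : ℝ := (∫ t in (0 : ℝ)..(2 * Real.pi), h.1 t) / ∫ t in (0 : ℝ)..(2 * Real.pi), β t with hc
  let G : ℝ → ℝ := fun t => h.1 t - c * β t
  have hGs : ContDiff ℝ ∞ G := h.2.1.sub (contDiff_const.mul hβs)
  have hGp : Function.Periodic G (2 * Real.pi) := by
    intro t
    simp only [G]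
    rw [h.2.2, hβp]
  have hGi : ∫ t in (0 : ℝ)..(2 * Real.pi), G t = 0 := by
    simp only [G]
    have hcont : Continuous fun t => c * β t := continuous_const.mul hβs.continuous
    rw [intervalIntegral.integral_sub (h.continuous.intervalIntegrable _ _)
      (hcont.intervalIntegrable _ _),
      intervalIntegral.integral_const_mul, hc, div_mul_cancel₀ _ hβi.ne', sub_self]
  have hd : ∀ t, HasDerivAt (fun x => ∫ s in (0 : ℝ)..x, G s) (G t) t := fun t =>
    intervalIntegral.integral_hasDerivAt_right (hGs.continuous.intervalIntegrable _ _)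
      (hGs.continuous.stronglyMeasurableAtFilter _ _) hGs.continuous.continuousAt
  refine ⟨⟨fun x => ∫ s in (0 : ℝ)..x, G s, ?_, ?_⟩, ?_⟩
  · refine contDiff_infty_iff_deriv.2 ⟨fun t => (hd t).differentiableAt, ?_⟩
    rw [show deriv (fun x => ∫ s in (0 : ℝ)..x, G s) = G from funext fun t => (hd t).deriv]
    exact hGs
  · intro t
    show ∫ s in (0 : ℝ)..(t + 2 * Real.pi), G s = ∫ s in (0 : ℝ)..t, G s
    have hi : ∀ x y, IntervalIntegrable G MeasureTheory.volume x y :=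
      fun x y => hGs.continuous.intervalIntegrable _ _
    rw [← intervalIntegral.integral_add_adjacent_intervals (hi 0 t) (hi t _),
      hGp.intervalIntegral_add_eq t 0, zero_add, hGi, add_zero]
  · intro t ht
    rw [(hd t).deriv]
    simp [G, hβ0 t ht]

/-- The von Neumann algebra `(S ∪ S*)''` generated by a set `S` of operators. -/
noncomputable def vonNeumannClosure (S : Set (Fock →L[ℂ] Fock)) : VonNeumannAlgebra Fock where
  toStarSubalgebra := StarSubalgebra.centralizer ℂ
    (StarSubalgebra.centralizer ℂ S : Set (Fock →L[ℂ] Fock))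
  centralizer_centralizer' := by simp

/-- The U(1)-current net: `A(J) = {W(f) : supp f ⊂ J}''`. -/
noncomputable def localAlg (J : Arc) : VonNeumannAlgebra Fock :=
  vonNeumannClosure {T | ∃ f : TestFun, SuppIn f J ∧ T = weyl f}

/-- The type of elements of `A(J)`. -/
abbrev LocalAlg (J : Arc) : Type := (localAlg J).toStarSubalgebra

theorem localAlg_mono {J K : Arc} (h : J.carrier ⊆ K.carrier) {x : Fock →L[ℂ] Fock}
    (hx : x ∈ (localAlg J).toStarSubalgebra) : x ∈ (localAlg K).toStarSubalgebra := by
  refine StarSubalgebra.centralizer_le ℂ _ _ (SetLike.coe_subset_coe.2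
    (StarSubalgebra.centralizer_le ℂ _ _ ?_)) hx
  rintro _ ⟨f, hf, rfl⟩
  exact ⟨f, hf.trans h, rfl⟩

/-- A representation of the net on the vacuum space: a compatible family of representations of the
local algebras. -/
structure NetRep where
  toFun : ∀ J : Arc, LocalAlg J →⋆ₐ[ℂ] (Fock →L[ℂ] Fock)
  compat : ∀ (J K : Arc) (h : J.carrier ⊆ K.carrier) (x : LocalAlg J),
    toFun K ⟨x, localAlg_mono h x.2⟩ = toFun J x

/-- `Ad W(H)`. -/
noncomputable def weylConj (H : TestFun) : (Fock →L[ℂ] Fock) →⋆ₐ[ℂ] (Fock →L[ℂ] Fock) where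
  toFun x := weyl H * x * star (weyl H)
  map_one' := by rw [mul_one, weyl_mul_star]
  map_mul' x y := by
    rw [show weyl H * x * star (weyl H) * (weyl H * y * star (weyl H)) =
      weyl H * x * (star (weyl H) * weyl H) * y * star (weyl H) by simp only [mul_assoc],
      star_weyl_mul]
    simp only [mul_assoc, one_mul]
  map_zero' := by simp
  map_add' x y := by simp [mul_add, add_mul]
  commutes' r := by
    rw [← Algebra.commutes, mul_assoc, weyl_mul_star, mul_one]
  map_star' x := by simp [mul_assoc]

theorem integral_mul_congr {f h g : TestFun} {J : Arc} (hf : SuppIn f J)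
    (H : ∀ t ∈ J.carrier, g.1 t = h.1 t) :
    ∫ t in (0 : ℝ)..(2 * Real.pi), f.1 t * g.1 t = ∫ t in (0 : ℝ)..(2 * Real.pi), f.1 t * h.1 t := by
  refine intervalIntegral.integral_congr fun t _ => ?_
  show f.1 t * g.1 t = f.1 t * h.1 t
  by_cases ht : t ∈ J.carrier
  · rw [H t ht]
  · have : f.1 t = 0 := by
      by_contra h0
      exact ht (hf (subset_tsupport _ h0))
    rw [this, zero_mul, zero_mul]

theorem weylConj_congr {H K h : TestFun} {J : Arc} (hH : ∀ t ∈ J.carrier, deriv H.1 t = h.1 t)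
    (hK : ∀ t ∈ J.carrier, deriv K.1 t = h.1 t) (x : LocalAlg J) :
    weylConj H x = weylConj K x := by
  have hgen : ∀ f : TestFun, SuppIn f J →
      weyl H * weyl f * star (weyl H) = weyl K * weyl f * star (weyl K) := by
    intro f hf
    rw [weyl_conj, weyl_conj]
    have h1 := integral_mul_congr (g := H.deriv) hf hH
    have h2 := integral_mul_congr (g := K.deriv) hf hK
    have h3 := h1.trans h2.symm
    simp only [TestFun.deriv] at h3
    rw [h3]
  have hcomm : ∀ f : TestFun, SuppIn f J →
      weyl f * (star (weyl K) * weyl H) = (star (weyl K) * weyl H) * weyl f := by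
    intro f hf
    have h1 := congrArg (fun T => star (weyl K) * T * weyl H) (hgen f hf)
    simp only [mul_assoc, star_weyl_mul, mul_one] at h1
    rw [← mul_assoc (star (weyl K)) (weyl K), star_weyl_mul, one_mul] at h1
    rw [mul_assoc, h1]
  have hmem : star (weyl K) * weyl H ∈ (StarSubalgebra.centralizer ℂ
      {T | ∃ f : TestFun, SuppIn f J ∧ T = weyl f} : StarSubalgebra ℂ (Fock →L[ℂ] Fock)) := by
    rw [StarSubalgebra.mem_centralizer_iff]
    rintro _ ⟨f, hf, rfl⟩
    refine ⟨hcomm f hf, ?_⟩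
    rw [star_weyl]
    refine hcomm (-f) ?_
    have : tsupport (-f : TestFun).1 = tsupport f.1 := by
      show closure (Function.support (-f.1)) = closure (Function.support f.1)
      rw [Function.support_neg]
    rw [SuppIn, this]
    exact hf
  have hx := (StarSubalgebra.mem_centralizer_iff ℂ).1 x.2 _ hmem
  have h1 := congrArg (fun T => weyl K * T * star (weyl H)) hx.1
  simp only [mul_assoc, weyl_mul_star, mul_one] at h1
  rw [← mul_assoc (weyl K) (star (weyl K)), weyl_mul_star, one_mul] at h1
  show weyl H * x.1 * star (weyl H) = weyl K * x.1 * star (weyl K)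
  rw [mul_assoc, h1, mul_assoc]

/-- A test function whose derivative agrees with `h` on the interval `J`. -/
noncomputable def primitive (h : TestFun) (J : Arc) : TestFun := (exists_primitive h J).choose

theorem primitive_spec (h : TestFun) (J : Arc) :
    ∀ t ∈ J.carrier, deriv (primitive h J).1 t = h.1 t := (exists_primitive h J).choose_spec

/-- The representation `σ_h` of the net. On `A(J)` it is implemented by `Ad W(H)` with `H' = h` on `J`,
and it is independent of the choice of `H` (`weylConj_congr`); it sends `W(f)` to
`exp (i ∫ f h) W(f)` (`sigma_weyl`). -/
noncomputable def sigma (h : TestFun) : NetRep where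
  toFun J := (weylConj (primitive h J)).comp (localAlg J).toStarSubalgebra.subtype
  compat J K hJK x := by
    exact weylConj_congr (fun t ht => primitive_spec h K t (hJK ht)) (primitive_spec h J) x

theorem sigma_weyl (h : TestFun) (J : Arc) (f : TestFun) (hf : SuppIn f J)
    (hW : weyl f ∈ (localAlg J).toStarSubalgebra) :
    (sigma h).toFun J ⟨weyl f, hW⟩ =
      Complex.exp (I * ((∫ t in (0 : ℝ)..(2 * Real.pi), f.1 t * h.1 t : ℝ) : ℂ)) • weyl f := by
  show weyl _ * weyl f * star (weyl _) = _
  rw [weyl_conj]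
  have h1 := integral_mul_congr (g := (primitive h J).deriv) hf (primitive_spec h J)
  simp only [TestFun.deriv] at h1
  rw [h1]

theorem weyl_mem {f : TestFun} {J : Arc} (hf : SuppIn f J) :
    weyl f ∈ (localAlg J).toStarSubalgebra := by
  refine (StarSubalgebra.mem_centralizer_iff ℂ).2 fun g hg => ?_
  have h1 := (StarSubalgebra.mem_centralizer_iff ℂ).1 hg (weyl f) ⟨f, hf, rfl⟩
  have h2 := (StarSubalgebra.mem_centralizer_iff ℂ).1 (star_mem hg) (weyl f) ⟨f, hf, rfl⟩
  exact ⟨h1.1.symm, h2.1.symm⟩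

/-! Automorphisms and the DHR braiding. -/

/-- `ρ` is an automorphism of the net: `ρ_J(A(J)) = A(J)` for every interval `J`. -/
def NetRep.IsAutomorphism (ρ : NetRep) : Prop :=
  ∀ J : Arc, Set.range (ρ.toFun J) = (localAlg J : Set (Fock →L[ℂ] Fock))

/-- `ρ` is localized in `J`: it is the identity on the algebra of the interior of the
complement of `J`. -/
def NetRep.IsLocalizedIn (ρ : NetRep) (J : Arc) : Prop :=
  ∀ x : LocalAlg J.compl, ρ.toFun J.compl x = x

/-- `V` is a charge transporter from `ρ`, localized in `I₁`, to `ρ'`, localized in `I₂`: a unitary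
intertwiner which belongs to `A(J)` for every interval `J` containing `I₁` and `I₂`. -/
structure IsChargeTransporter (ρ ρ' : NetRep) (I₁ I₂ : Arc) (V : Fock →L[ℂ] Fock) : Prop where
  unitary : V ∈ unitary (Fock →L[ℂ] Fock)
  intertwines : ∀ (J : Arc) (x : LocalAlg J), V * ρ.toFun J x = ρ'.toFun J x * V
  mem : ∀ J : Arc, I₁.carrier ⊆ J.carrier → I₂.carrier ⊆ J.carrier → V ∈ localAlg J

/-- The operator `ρ₂(V₁*) V₂* V₁ ρ₁(V₂)`, for charge transporters `V₁, V₂` in `A(K)`. -/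
noncomputable def braidingOp (ρ₁ ρ₂ : NetRep) (K : Arc) (V₁ V₂ : LocalAlg K) : Fock →L[ℂ] Fock :=
  ρ₂.toFun K (star V₁) * star (V₂ : Fock →L[ℂ] Fock) * (V₁ : Fock →L[ℂ] Fock) * ρ₁.toFun K V₂

/-- `ε` is a value of the DHR braiding of `ρ₁` and `ρ₂`, both localized in `I`, computed inside the
interval `K` (which leaves out the point at infinity) by transporting `ρ₁` to some representation
localized in `I₁` and `ρ₂` to some representation localized in `I₂`. -/
def IsDHRBraiding (ρ₁ ρ₂ : NetRep) (I I₁ I₂ K : Arc) (ε : Fock →L[ℂ] Fock) : Prop :=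
  ∃ (τ₁ τ₂ : NetRep) (V₁ V₂ : LocalAlg K),
    τ₁.IsLocalizedIn I₁ ∧ τ₂.IsLocalizedIn I₂ ∧
    IsChargeTransporter ρ₁ τ₁ I I₁ V₁ ∧ IsChargeTransporter ρ₂ τ₂ I I₂ V₂ ∧
    ε = braidingOp ρ₁ ρ₂ K V₁ V₂

/-- `I`, `I₁`, `I₂` are pairwise disjoint intervals contained in the interval `K`. -/
structure IsConfiguration (I I₁ I₂ K : Arc) : Prop where
  subset : I.carrier ⊆ K.carrier
  subset₁ : I₁.carrier ⊆ K.carrier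
  subset₂ : I₂.carrier ⊆ K.carrier
  disjoint₁ : Disjoint I.carrier I₁.carrier
  disjoint₂ : Disjoint I.carrier I₂.carrier
  disjoint₁₂ : Disjoint I₁.carrier I₂.carrier

/-- Inside the interval `K`, with its counterclockwise order, `I₁` lies before (in the past of)
`I₂`. -/
def Precedes (K I₁ I₂ : Arc) : Prop :=
  ∀ s ∈ Set.Ioo K.a K.b, ∀ t ∈ Set.Ioo K.a K.b, s ∈ I₁.carrier → t ∈ I₂.carrier → s < t

/-- The automorphism written `σ_{αh}`: the automorphism `σ_g` for `g = √(2π) α h`. When `∫ h = 1`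
it has charge `α`. -/
noncomputable def chargedAut (h : TestFun) (α : ℝ) : NetRep :=
  sigma ((Real.sqrt (2 * Real.pi) * α) • h)

end U1Current

/-!
For a smooth `H`, conjugation by `W(H)` is an automorphism of every local algebra, and `σ_g` is
implemented on `A(J)` by any `H` with `H' = g` on `J`. The charge `g` can be moved from `I` to a
function `k` supported in `I₁` and of the same integral by `W(F)`, where `F' = k - g`. Such an `F` is
constant on the two gaps between `I` and `I₁`; as `W(F)` depends on `F'` only
(`weyl_eq_of_deriv_eq`), the constant can be normalized to zero on either gap, so `W(F)` lies in
`A(J)` for every interval `J` containing `I` and `I₁` (`isChargeTransporter_weyl`).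

Every choice of transporters gives the same braiding (`isDHRBraiding_sigma_iff`), and Haag duality is
not needed for this. Arbitrary transporters are `V_i = U_i W(F_i)` with `U_i` commuting with the algebra
of the complement of `I_i`. Since that complement is an interval containing `I` and the other
`I_j`, it is one of the intervals whose algebras contain `U_j`, so `U₁` and `U₂` commute. Moreover
`σ_{k₁}` fixes `U₂`: on `A(K)` it is implemented by a Weyl operator localized in the complement of `I₂`,
because the charge of `k₁` can be cancelled by an opposite charge outside `K`
(`sigma_apply_eq_self`). Hence `U₁` and `U₂` drop out of the braiding operator (`braidingOp_mul`).

For the Weyl operators, with `F_i` normalized to vanish outside `K`, the Weyl relations give the phase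
`∫ F₂ k₁ - ∫ F₁ g₂` (`braidingOp_weyl`). Let `A_i`, `H` be the primitives of `k_i`, `h` from the
left end of `K`, so that `F_i = A_i - q_i H`. The integrand is `A₂ A₁' - q₂ (H A₁)' + q₁ q₂ (H² / 2)'`,
and on the support of `A₁' = k₁` the function `A₂` equals `q₂` if `I₂` lies before `I₁` and `0` if it
lies after. So the phase is `± q₁ q₂ / 2` (`integral_phase`), that is `± π α₁ α₂` for
`q_i = √(2π) α_i`.
-/

namespace U1Current

open Complex (I)
open scoped ContDiff

/-! ### Arcs of the circle -/

theorem Arc.isOpen_carrier (J : Arc) : IsOpen J.carrier := by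
  have : J.carrier = ⋃ k : ℤ, (fun t : ℝ => t + k * (2 * Real.pi)) ⁻¹' Set.Ioo J.a J.b := by
    ext t
    simp only [Arc.carrier, Set.mem_iUnion, Set.mem_preimage]
    rfl
  rw [this]
  exact isOpen_iUnion fun k => isOpen_Ioo.preimage (by fun_prop)

theorem Arc.add_int_mul_mem_carrier {J : Arc} {t : ℝ} (k : ℤ) :
    t + k * (2 * Real.pi) ∈ J.carrier ↔ t ∈ J.carrier := by
  constructor
  · rintro ⟨l, hl⟩
    refine ⟨k + l, ?_⟩
    convert hl using 1
    push_cast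
    ring
  · rintro ⟨l, hl⟩
    refine ⟨l - k, ?_⟩
    convert hl using 1
    push_cast
    ring

theorem Arc.mem_carrier_of_mem_Ioo {J : Arc} {t : ℝ} (ht : t ∈ Set.Ioo J.a J.b) :
    t ∈ J.carrier :=
  ⟨0, by simpa using ht⟩

theorem Arc.notMem_carrier_of_mem_Icc {J : Arc} {t : ℝ} (ht : t ∈ Set.Icc J.b (J.a + 2 * Real.pi)) :
    t ∉ J.carrier := by
  rintro ⟨k, h1, h2⟩
  have hpi := Real.pi_pos
  have hJ := J.a_lt_b
  have hJ2 := J.b_lt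
  have hk1 : (-1 : ℝ) < k := by
    by_contra h
    nlinarith [ht.2]
  have hk2 : (k : ℝ) < 0 := by
    by_contra h
    nlinarith [ht.1]
  have h3 : -1 < k := by exact_mod_cast hk1
  have h4 : k < 0 := by exact_mod_cast hk2
  omega

theorem Arc.mem_Ioo_of_mem_carrier {J : Arc} {t : ℝ}
    (ht : t ∈ Set.Icc J.a (J.a + 2 * Real.pi)) (h : t ∈ J.carrier) : t ∈ Set.Ioo J.a J.b := by
  refine ⟨lt_of_le_of_ne ht.1 ?_, ?_⟩
  · intro he
    refine Arc.notMem_carrier_of_mem_Icc (J := J) ⟨J.b_lt.le, le_rfl⟩ ?_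
    simpa [he] using (Arc.add_int_mul_mem_carrier (J := J) (t := t) 1).2 h
  · by_contra! hc
    exact Arc.notMem_carrier_of_mem_Icc ⟨hc, ht.2⟩ h

theorem Arc.exists_lift_of_notMem {J : Arc} {t : ℝ} (ht : t ∉ J.carrier) :
    ∃ k : ℤ, t + k * (2 * Real.pi) ∈ Set.Icc J.b (J.a + 2 * Real.pi) := by
  obtain ⟨k, hk, -⟩ := existsUnique_add_zsmul_mem_Ico Real.two_pi_pos t J.b
  rw [zsmul_eq_mul] at hk
  refine ⟨k, hk.1, ?_⟩
  by_contra! h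
  refine ht ⟨k - 1, ?_⟩
  push_cast
  constructor <;> linarith [hk.2]

theorem Arc.disjoint_compl (J : Arc) : Disjoint J.carrier J.compl.carrier := by
  rw [Set.disjoint_right]
  rintro t ⟨k, hk⟩ ht
  exact Arc.notMem_carrier_of_mem_Icc (Set.Ioo_subset_Icc_self hk)
    ((Arc.add_int_mul_mem_carrier k).2 ht)

theorem Arc.subset_compl_of_disjoint {J K : Arc} (h : Disjoint J.carrier K.carrier) :
    K.carrier ⊆ J.compl.carrier := by
  intro t ht
  have ht' : t ∉ closure J.carrier :=
    fun hc => Set.disjoint_left.1 (h.closure_left K.isOpen_carrier) hc ht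
  obtain ⟨k, hk⟩ := Arc.exists_lift_of_notMem fun hc => ht' (subset_closure hc)
  have hcl : t + k * (2 * Real.pi) ∉ closure J.carrier := fun hc =>
    Set.disjoint_left.1 (h.closure_left K.isOpen_carrier) hc
      ((Arc.add_int_mul_mem_carrier k).2 ht)
  have hJ := closure_mono (fun x hx => Arc.mem_carrier_of_mem_Ioo (J := J) hx)
  rw [closure_Ioo J.a_lt_b.ne] at hJ
  have hshift : ∀ x ∈ Set.Icc J.a J.b, x + 2 * Real.pi ∈ closure J.carrier := by
    intro x hx
    refine map_mem_closure (f := fun y : ℝ => y + 2 * Real.pi) (by fun_prop) (hJ hx) ?_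
    intro y hy
    simpa using (Arc.add_int_mul_mem_carrier (J := J) (t := y) 1).2 hy
  refine ⟨k, lt_of_le_of_ne hk.1 ?_, lt_of_le_of_ne hk.2 ?_⟩
  · intro he
    exact hcl (he ▸ hJ ⟨J.a_lt_b.le, le_rfl⟩)
  · intro he
    exact hcl (he ▸ hshift J.a ⟨le_rfl, J.a_lt_b.le⟩)

theorem Arc.compl_subset_compl {J K : Arc} (h : J.carrier ⊆ K.carrier) :
    K.compl.carrier ⊆ J.compl.carrier :=
  Arc.subset_compl_of_disjoint (K.disjoint_compl.mono_left h)

/-- Inside an arc `K`, which leaves out a point of the circle, a smaller arc is an interval of the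
line. -/
theorem Arc.exists_Ioo {J K : Arc} (h : J.carrier ⊆ K.carrier) :
    ∃ c d : ℝ, K.a ≤ c ∧ d ≤ K.b ∧ c < d ∧
      ∀ t ∈ Set.Ioo K.a K.b, t ∈ J.carrier ↔ t ∈ Set.Ioo c d := by
  have hpi := Real.pi_pos
  have hJ := J.a_lt_b
  have hK := K.b_lt
  have hKb : K.b ∉ K.carrier := Arc.notMem_carrier_of_mem_Icc ⟨le_rfl, K.b_lt.le⟩
  have hKa : K.a ∉ K.carrier := fun hc => Arc.notMem_carrier_of_mem_Icc (J := K) ⟨K.b_lt.le, le_rfl⟩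
    (by simpa using (Arc.add_int_mul_mem_carrier (J := K) (t := K.a) 1).2 hc)
  -- a lift of `J` which meets `(K.a, K.b)` cannot cross the endpoints of `K`
  have key : ∀ (k : ℤ) (t : ℝ), t ∈ Set.Ioo K.a K.b → t + k * (2 * Real.pi) ∈ Set.Ioo J.a J.b →
      K.a ≤ J.a - k * (2 * Real.pi) ∧ J.b - k * (2 * Real.pi) ≤ K.b := by
    intro k t ht hk
    constructor
    · by_contra! hlt
      exact hKa (h ⟨k, by linarith, by linarith [hk.2, ht.1]⟩)
    · by_contra! hlt
      exact hKb (h ⟨k, by linarith [hk.1, ht.2], by linarith⟩)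
  obtain ⟨k, t, ht, hk⟩ : ∃ (k : ℤ) (t : ℝ), t ∈ Set.Ioo K.a K.b ∧
      t + k * (2 * Real.pi) ∈ Set.Ioo J.a J.b := by
    have hm : (J.a + J.b) / 2 ∈ Set.Ioo J.a J.b := ⟨by linarith, by linarith⟩
    obtain ⟨l, hl⟩ := h (Arc.mem_carrier_of_mem_Ioo hm)
    refine ⟨-l, _, hl, ?_⟩
    push_cast
    rwa [neg_mul, add_neg_cancel_right]
  obtain ⟨h1, h2⟩ := key k t ht hk
  refine ⟨_, _, h1, h2, by linarith, fun s hs => ⟨?_, fun hs' => ⟨k, by linarith [hs'.1],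
    by linarith [hs'.2]⟩⟩⟩
  rintro ⟨l, hl⟩
  obtain ⟨h3, h4⟩ := key l s hs hl
  -- two different lifts inside `(K.a, K.b)` would be more than a full turn apart
  have hkl : l = k := by
    have h5 : ((l : ℝ) - k) < 1 := by
      by_contra! hc
      nlinarith
    have h6 : ((k : ℝ) - l) < 1 := by
      by_contra! hc
      nlinarith
    have h7 : l - k < 1 := by exact_mod_cast h5
    have h8 : k - l < 1 := by exact_mod_cast h6
    omega
  subst hkl
  exact ⟨by linarith [hl.1], by linarith [hl.2]⟩

theorem precedes_or_precedes {K I₁ I₂ : Arc} (h₁ : I₁.carrier ⊆ K.carrier)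
    (h₂ : I₂.carrier ⊆ K.carrier) (h : Disjoint I₁.carrier I₂.carrier) :
    Precedes K I₂ I₁ ∨ Precedes K I₁ I₂ := by
  obtain ⟨c₁, d₁, hc₁, hd₁, hcd₁, H₁⟩ := Arc.exists_Ioo h₁
  obtain ⟨c₂, d₂, hc₂, hd₂, hcd₂, H₂⟩ := Arc.exists_Ioo h₂
  have : d₂ ≤ c₁ ∨ d₁ ≤ c₂ := by
    by_contra! hc
    obtain ⟨t, ht1, ht2⟩ := exists_between
      (max_lt (lt_min hcd₁ hc.1) (lt_min hc.2 hcd₂) : max c₁ c₂ < min d₁ d₂)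
    rw [max_lt_iff] at ht1
    rw [lt_min_iff] at ht2
    have htK : t ∈ Set.Ioo K.a K.b := ⟨by linarith, by linarith⟩
    exact Set.disjoint_left.1 h ((H₁ t htK).2 ⟨ht1.1, ht2.1⟩) ((H₂ t htK).2 ⟨ht1.2, ht2.2⟩)
  rcases this with hle | hle
  · left
    intro s hs t ht hsI htI
    linarith [((H₂ s hs).1 hsI).2, ((H₁ t ht).1 htI).1]
  · right
    intro s hs t ht hsI htI
    linarith [((H₁ s hs).1 hsI).2, ((H₂ t ht).1 htI).1]

/-! ### Test functions supported in an arc -/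

theorem SuppIn.eq_zero {f : TestFun} {J : Arc} (hf : SuppIn f J) {t : ℝ} (ht : t ∉ J.carrier) :
    f.1 t = 0 :=
  image_eq_zero_of_notMem_tsupport fun h => ht (hf h)

theorem SuppIn.smul {f : TestFun} {J : Arc} (hf : SuppIn f J) (c : ℝ) : SuppIn (c • f) J :=
  (closure_mono (Function.support_const_smul_subset c f.1)).trans hf

theorem SuppIn.sub {f g : TestFun} {J : Arc} (hf : SuppIn f J) (hg : SuppIn g J) :
    SuppIn (f - g) J :=
  (tsupport_sub f.1 g.1).trans (Set.union_subset hf hg)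

theorem SuppIn.mono {f : TestFun} {J K : Arc} (hf : SuppIn f J) (h : J.carrier ⊆ K.carrier) :
    SuppIn f K :=
  hf.trans h

theorem integral_sub_testFun (f g : TestFun) (x y : ℝ) :
    ∫ t in x..y, (f - g : TestFun).1 t = (∫ t in x..y, f.1 t) - ∫ t in x..y, g.1 t :=
  intervalIntegral.integral_sub (f.continuous.intervalIntegrable _ _)
    (g.continuous.intervalIntegrable _ _)

theorem integral_smul_testFun (c : ℝ) (f : TestFun) (x y : ℝ) :
    ∫ t in x..y, (c • f : TestFun).1 t = c * ∫ t in x..y, f.1 t :=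
  intervalIntegral.integral_const_mul _ _

theorem TestFun.integral_period (f : TestFun) (x : ℝ) :
    ∫ t in x..(x + 2 * Real.pi), f.1 t = ∫ t in (0 : ℝ)..(2 * Real.pi), f.1 t := by
  simpa using Function.Periodic.intervalIntegral_add_eq f.2.2 x 0

theorem TestFun.hasDerivAt_integral (f : TestFun) (x t : ℝ) :
    HasDerivAt (fun y => ∫ s in x..y, f.1 s) (f.1 t) t :=
  intervalIntegral.integral_hasDerivAt_right (f.continuous.intervalIntegrable _ _)
    (f.continuous.stronglyMeasurableAtFilter _ _) f.continuous.continuousAt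

/-- A function of total charge zero supported in `J` has a primitive on the circle, and the one
which vanishes at an endpoint of `J` is supported in `J`. -/
theorem exists_suppIn_primitive {f : TestFun} {J : Arc} (hf : SuppIn f J)
    (h0 : ∫ t in (0 : ℝ)..(2 * Real.pi), f.1 t = 0) :
    ∃ F : TestFun, SuppIn F J ∧ ∀ t, deriv F.1 t = f.1 t := by
  have hi : ∀ x y, IntervalIntegrable f.1 MeasureTheory.volume x y :=
    fun x y => f.continuous.intervalIntegrable _ _
  have hd := f.hasDerivAt_integral J.b
  have hper : Function.Periodic (fun x => ∫ s in J.b..x, f.1 s) (2 * Real.pi) := by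
    intro t
    show ∫ s in J.b..(t + 2 * Real.pi), f.1 s = ∫ s in J.b..t, f.1 s
    rw [← intervalIntegral.integral_add_adjacent_intervals (hi J.b t) (hi t _),
      f.integral_period, h0, add_zero]
  refine ⟨⟨fun x => ∫ s in J.b..x, f.1 s, ?_, hper⟩, ?_, fun t => (hd t).deriv⟩
  · refine contDiff_infty_iff_deriv.2 ⟨fun t => (hd t).differentiableAt, ?_⟩
    rw [show deriv (fun x => ∫ s in J.b..x, f.1 s) = f.1 from funext fun t => (hd t).deriv]
    exact f.2.1
  · intro t ht
    by_contra htJ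
    obtain ⟨k, hk⟩ := Arc.exists_lift_of_notMem htJ
    set u := t + k * (2 * Real.pi) with hu
    have hzero : ∀ s ∈ Set.Icc J.b (J.a + 2 * Real.pi), f.1 s = 0 := fun s hs =>
      hf.eq_zero (Arc.notMem_carrier_of_mem_Icc hs)
    have hFu : ∫ s in J.b..u, f.1 s = 0 := by
      refine intervalIntegral.integral_zero_ae (Filter.Eventually.of_forall fun s hs => ?_)
      rw [Set.uIoc_of_le hk.1] at hs
      exact hzero s ⟨hs.1.le, hs.2.trans hk.2⟩
    have hnhds : (tsupport f.1)ᶜ ∈ nhds u := (isClosed_tsupport f.1).isOpen_compl.mem_nhds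
      fun hc => Arc.notMem_carrier_of_mem_Icc hk (hf hc)
    obtain ⟨ε, hε, hball⟩ := Metric.mem_nhds_iff.1 hnhds
    have hev : ∀ᶠ s in nhds u, ∫ x in J.b..s, f.1 x = 0 := by
      filter_upwards [Metric.ball_mem_nhds u hε] with s hs
      rw [← intervalIntegral.integral_add_adjacent_intervals (hi J.b u) (hi u s), hFu, zero_add]
      refine intervalIntegral.integral_zero_ae (Filter.Eventually.of_forall fun x hx => ?_)
      refine image_eq_zero_of_notMem_tsupport (hball ?_)
      exact (convex_ball u ε).ordConnected.uIcc_subset (Metric.mem_ball_self hε) hs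
        (Set.uIoc_subset_uIcc hx)
    refine notMem_tsupport_iff_eventuallyEq.2 ?_ ht
    have hcont : Filter.Tendsto (fun s : ℝ => s + k * (2 * Real.pi)) (nhds t) (nhds u) :=
      (Continuous.tendsto (by fun_prop) t)
    filter_upwards [hcont.eventually hev] with s hs
    exact (hper.int_mul k s).symm.trans hs

/-- Every arc carries a test function of total integral one. -/
theorem exists_bump (J : Arc) :
    ∃ f : TestFun, SuppIn f J ∧ ∫ t in (0 : ℝ)..(2 * Real.pi), f.1 t = 1 := by
  have hJ1 := J.a_lt_b
  have hJ2 := J.b_lt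
  have hpi := Real.pi_pos
  set m : ℝ := (J.a + J.b) / 2 with hm
  -- half of the distance from the midpoint to the endpoints, so that the support stays inside `J`
  set δ : ℝ := (J.b - J.a) / 4 with hδ
  have hδ0 : 0 < δ := by rw [hδ]; linarith
  have hδ1 : δ < Real.pi := by rw [hδ]; linarith
  let β : ℝ → ℝ := fun t => Real.smoothTransition (Real.cos (t - m) - Real.cos δ)
  have hβs : ContDiff ℝ ∞ β := Real.smoothTransition.contDiff.comp
    ((Real.contDiff_cos.comp (contDiff_id.sub contDiff_const)).sub contDiff_const)
  have hβp : Function.Periodic β (2 * Real.pi) := by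
    intro t
    simp only [β]
    rw [add_sub_right_comm, Real.cos_add_two_pi]
  have hsupp : tsupport β ⊆ J.carrier := by
    have h1 : tsupport β ⊆ {t | Real.cos δ ≤ Real.cos (t - m)} := by
      refine closure_minimal (fun t ht => ?_) (isClosed_le (by fun_prop) (by fun_prop))
      by_contra hc
      rw [Set.mem_ofPred_eq, not_le] at hc
      exact ht (Real.smoothTransition.zero_of_nonpos (by linarith))
    refine h1.trans fun t ht => ?_
    by_contra htJ
    obtain ⟨k, hk1, hk2⟩ := Arc.exists_lift_of_notMem htJ
    have hc : Real.cos (t - m) = Real.cos (t + k * (2 * Real.pi) - m) := by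
      rw [show t + k * (2 * Real.pi) - m = t - m + k * (2 * Real.pi) by ring,
        Real.cos_add_int_mul_two_pi]
    set x := t + k * (2 * Real.pi) - m with hx
    have hx1 : δ < x := by rw [hx, hm, hδ]; linarith
    have hx2 : δ < 2 * Real.pi - x := by rw [hx, hm, hδ]; linarith
    refine absurd (hc ▸ ht : Real.cos δ ≤ Real.cos x) (not_le.2 ?_)
    rcases le_total x Real.pi with hxp | hxp
    · exact Real.cos_lt_cos_of_nonneg_of_le_pi hδ0.le hxp hx1
    · rw [← Real.cos_two_pi_sub x]
      exact Real.cos_lt_cos_of_nonneg_of_le_pi hδ0.le (by linarith) hx2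
  have hβi : 0 < ∫ t in (0 : ℝ)..(2 * Real.pi), β t := by
    refine intervalIntegral.integral_pos Real.two_pi_pos hβs.continuous.continuousOn
      (fun t _ => Real.smoothTransition.nonneg _) ?_
    obtain ⟨y, hy, hyx⟩ := hβp.exists_mem_Ico₀ Real.two_pi_pos m
    refine ⟨y, Set.Ico_subset_Icc_self hy, ?_⟩
    rw [← hyx]
    refine Real.smoothTransition.pos_of_pos ?_
    rw [sub_self, Real.cos_zero, sub_pos]
    have := Real.cos_lt_cos_of_nonneg_of_le_pi le_rfl hδ1.le hδ0
    rwa [Real.cos_zero] at this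
  have hβ : SuppIn ⟨β, hβs, hβp⟩ J := hsupp
  refine ⟨(∫ t in (0 : ℝ)..(2 * Real.pi), β t)⁻¹ • ⟨β, hβs, hβp⟩, hβ.smul _, ?_⟩
  rw [integral_smul_testFun]
  exact inv_mul_cancel₀ hβi.ne'

/-! ### Weyl operators and the automorphisms they implement -/

/-- The zero mode of the current vanishes in the vacuum representation, so `W(F)` depends only on
the derivative of `F`. -/
theorem weyl_eq_of_deriv_eq {F G : TestFun} (h : ∀ t, _root_.deriv F.1 t = _root_.deriv G.1 t) :
    weyl F = weyl G := by
  have hd : F.deriv = G.deriv := Subtype.ext (funext h)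
  have : oneParticle F = oneParticle G := by
    ext n
    rw [oneParticle_apply, oneParticle_apply]
    have h1 := fourierMode_deriv F (-(n : ℤ))
    rw [hd, fourierMode_deriv G] at h1
    have hn : (I * ((-(n : ℤ) : ℤ) : ℂ)) ≠ 0 := mul_ne_zero Complex.I_ne_zero (by simp)
    rw [mul_left_cancel₀ hn h1]
  rw [weyl, weyl, this]

theorem weylConj_apply (H : TestFun) (x : Fock →L[ℂ] Fock) :
    weylConj H x = weyl H * x * star (weyl H) := rfl

theorem star_exp_I_mul_ofReal (r : ℝ) :
    star (Complex.exp (I * (r : ℂ))) = Complex.exp (-(I * r)) := by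
  rw [Complex.star_def, ← Complex.exp_conj]
  simp

theorem weylConj_weylConj (F H : TestFun) (x : Fock →L[ℂ] Fock) :
    weylConj F (weylConj H x) = weylConj (F + H) x := by
  obtain ⟨r, hr⟩ : ∃ r : ℝ, weyl F * weyl H = Complex.exp (I * (r : ℂ)) • weyl (F + H) :=
    ⟨-(1 / 2 * ∫ t in (0 : ℝ)..(2 * Real.pi), F.1 t * deriv H.1 t), by
      rw [weyl_mul]
      congr 2
      push_cast
      ring⟩
  have : weylConj F (weylConj H x) = (weyl F * weyl H) * x * star (weyl F * weyl H) := by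
    simp only [weylConj_apply, star_mul, mul_assoc]
  rw [this, hr, star_smul, star_exp_I_mul_ofReal, smul_mul_assoc, smul_mul_assoc, mul_smul_comm,
    smul_smul, ← Complex.exp_add, add_neg_cancel, Complex.exp_zero, one_smul, weylConj_apply]

theorem weyl_zero : weyl 0 = 1 := by
  rw [weyl, oneParticle_zero, smul_zero, displacement_zero]

theorem weylConj_zero (x : Fock →L[ℂ] Fock) : weylConj 0 x = x := by
  rw [weylConj_apply, weyl_zero, one_mul, star_one, mul_one]

theorem sigma_apply {h H : TestFun} {J : Arc} (hH : ∀ t ∈ J.carrier, deriv H.1 t = h.1 t)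
    (x : LocalAlg J) : (sigma h).toFun J x = weylConj H x :=
  weylConj_congr (primitive_spec h J) hH x

theorem weylConj_mem (H : TestFun) {J : Arc} {x : Fock →L[ℂ] Fock}
    (hx : x ∈ (localAlg J).toStarSubalgebra) :
    weylConj H x ∈ (localAlg J).toStarSubalgebra := by
  -- `Ad W(-H)` multiplies the generators by phases, so it preserves their commutant
  have key : ∀ c ∈ (StarSubalgebra.centralizer ℂ
      {T | ∃ f : TestFun, SuppIn f J ∧ T = weyl f} : StarSubalgebra ℂ (Fock →L[ℂ] Fock)),
      weylConj H x * c = c * weylConj H x := by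
    intro c hc
    have hcomm : ∀ (f : TestFun) (d : Fock →L[ℂ] Fock), weyl f * d = d * weyl f →
        weyl f * weylConj (-H) d = weylConj (-H) d * weyl f := by
      intro f d hd
      obtain ⟨z, hz⟩ : ∃ z : ℂ, weylConj H (weyl f) = z • weyl f := ⟨_, weyl_conj H f⟩
      have h2 : weylConj H (weyl f) * d = d * weylConj H (weyl f) := by
        rw [hz, smul_mul_assoc, mul_smul_comm, hd]
      have h3 := congrArg (weylConj (-H)) h2
      rw [map_mul, map_mul, weylConj_weylConj, neg_add_cancel, weylConj_zero] at h3
      exact h3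
    have hmem : weylConj (-H) c ∈ (StarSubalgebra.centralizer ℂ
        {T | ∃ f : TestFun, SuppIn f J ∧ T = weyl f} : StarSubalgebra ℂ (Fock →L[ℂ] Fock)) := by
      rw [StarSubalgebra.mem_centralizer_iff] at hc ⊢
      rintro _ ⟨f, hf, rfl⟩
      refine ⟨hcomm f c (hc _ ⟨f, hf, rfl⟩).1, ?_⟩
      rw [star_weyl]
      refine hcomm (-f) c ?_
      rw [← star_weyl]
      exact (hc _ ⟨f, hf, rfl⟩).2
    have h1 := ((StarSubalgebra.mem_centralizer_iff ℂ).1 hx _ hmem).1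
    have h2 := congrArg (weylConj H) h1
    rw [map_mul, map_mul, weylConj_weylConj, add_neg_cancel, weylConj_zero] at h2
    exact h2.symm
  refine (StarSubalgebra.mem_centralizer_iff ℂ).2 fun c hc => ?_
  exact ⟨(key c hc).symm, (key _ (star_mem hc)).symm⟩

theorem sigma_isAutomorphism (h : TestFun) : (sigma h).IsAutomorphism := by
  intro J
  refine Set.Subset.antisymm ?_ fun x hx => ?_
  · rintro _ ⟨x, rfl⟩
    exact weylConj_mem _ x.2
  · refine ⟨⟨weylConj (-primitive h J) x, weylConj_mem _ hx⟩, ?_⟩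
    rw [sigma_apply (primitive_spec h J), weylConj_weylConj, add_neg_cancel, weylConj_zero]

theorem sigma_isLocalizedIn {h : TestFun} {J : Arc} (hh : SuppIn h J) :
    (sigma h).IsLocalizedIn J := by
  intro x
  rw [sigma_apply (H := 0), weylConj_zero]
  intro t ht
  rw [hh.eq_zero (Set.disjoint_right.1 J.disjoint_compl ht)]
  exact deriv_const t 0

/-! ### Charge transporters -/

theorem weyl_mul_sigma_apply {g k F : TestFun} (hF : ∀ t, deriv F.1 t = (k - g).1 t) (J : Arc)
    (x : LocalAlg J) :
    weyl F * (sigma g).toFun J x = (sigma k).toFun J x * weyl F := by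
  have hH : ∀ t ∈ J.carrier, deriv (F + primitive g J).1 t = k.1 t := by
    intro t ht
    have h1 : deriv (F + primitive g J).1 t = deriv F.1 t + deriv (primitive g J).1 t :=
      ((F.hasDerivAt t).add ((primitive g J).hasDerivAt t)).deriv
    rw [h1, hF, primitive_spec g J t ht]
    exact sub_add_cancel _ _
  rw [sigma_apply hH, ← weylConj_weylConj, sigma_apply (primitive_spec g J), weylConj_apply F,
    mul_assoc, star_weyl_mul, mul_one]

theorem isChargeTransporter_weyl {g k F : TestFun} {I₀ I₁ : Arc} (hg : SuppIn g I₀)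
    (hk : SuppIn k I₁) (hF : ∀ t, deriv F.1 t = (k - g).1 t) :
    IsChargeTransporter (sigma g) (sigma k) I₀ I₁ (weyl F) where
  unitary := ⟨star_weyl_mul F, weyl_mul_star F⟩
  intertwines := weyl_mul_sigma_apply hF
  mem J h₀ h₁ := by
    have h0 : ∫ t in (0 : ℝ)..(2 * Real.pi), (k - g).1 t = 0 := by
      have hper := F.2.2 0
      rw [zero_add] at hper
      simp only [← hF]
      rw [intervalIntegral.integral_eq_sub_of_hasDerivAt (fun t _ => F.hasDerivAt t)
        (F.deriv.continuous.intervalIntegrable _ _), hper, sub_self]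
    -- the primitive supported in `J` differs from `F` by a constant
    obtain ⟨G, hGJ, hG⟩ := exists_suppIn_primitive ((hk.mono h₁).sub (hg.mono h₀)) h0
    rw [weyl_eq_of_deriv_eq fun t => (hF t).trans (hG t).symm]
    exact weyl_mem hGJ

/-- Two charge transporters from the same representation, with targets localized in the same
interval, differ by a unitary which commutes with the algebra of the complementary interval. -/
theorem IsChargeTransporter.commute_mul_star {ρ τ τ' : NetRep} {I₀ I₁ : Arc}
    {V W : Fock →L[ℂ] Fock} (hV : IsChargeTransporter ρ τ I₀ I₁ V)
    (hW : IsChargeTransporter ρ τ' I₀ I₁ W) (hτ : τ.IsLocalizedIn I₁)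
    (hτ' : τ'.IsLocalizedIn I₁) (x : LocalAlg I₁.compl) :
    (V * star W) * x = x * (V * star W) := by
  have h1 := hV.intertwines I₁.compl x
  have h2 := hW.intertwines I₁.compl x
  rw [hτ] at h1
  rw [hτ'] at h2
  have h3 : star W * x = ρ.toFun I₁.compl x * star W := by
    calc star W * x = star W * (x * W) * star W := by
          rw [mul_assoc, mul_assoc, hW.unitary.2, mul_one]
      _ = (star W * W) * ρ.toFun I₁.compl x * star W := by rw [← h2]; simp only [mul_assoc]
      _ = _ := by rw [hW.unitary.1, one_mul]
  rw [mul_assoc, h3, ← mul_assoc, h1, mul_assoc]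

/-- If `k` is supported in `I₁`, then `σ_k` acts trivially on the elements of `A(K)` which commute
with the algebra of the complement of an interval `I₂` disjoint from `I₁`: on `A(K)` it is
implemented by `W(H)` with `H` supported in that complement. The charge of `k` is compensated
outside `K`. -/
theorem sigma_apply_eq_self {k : TestFun} {I₁ I₂ K : Arc} (hk : SuppIn k I₁)
    (h₂ : I₂.carrier ⊆ K.carrier) (h₁₂ : Disjoint I₁.carrier I₂.carrier) {U : LocalAlg K}
    (hU : ∀ x : LocalAlg I₂.compl, (U : Fock →L[ℂ] Fock) * x = x * U) :
    (sigma k).toFun K U = U := by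
  obtain ⟨β, hβ, hβ1⟩ := exists_bump K.compl
  have h0 : ∫ t in (0 : ℝ)..(2 * Real.pi),
      (k - (∫ s in (0 : ℝ)..(2 * Real.pi), k.1 s) • β).1 t = 0 := by
    rw [integral_sub_testFun, integral_smul_testFun, hβ1, mul_one, sub_self]
  obtain ⟨H, hHJ, hH⟩ := exists_suppIn_primitive
    ((hk.mono (Arc.subset_compl_of_disjoint h₁₂.symm)).sub
      ((hβ.mono (Arc.compl_subset_compl h₂)).smul _)) h0
  rw [sigma_apply (H := H), weylConj_apply]
  · have := hU ⟨weyl H, weyl_mem hHJ⟩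
    simp only at this
    rw [← this, mul_assoc, weyl_mul_star, mul_one]
  · intro t ht
    have hβ0 : β.1 t = 0 := hβ.eq_zero (Set.disjoint_left.1 K.disjoint_compl ht)
    rw [hH]
    show k.1 t - _ * β.1 t = k.1 t
    rw [hβ0, mul_zero, sub_zero]

/-! ### Independence of the braiding of the choices -/

theorem braidingOp_eq (ρ₁ ρ₂ : NetRep) (K : Arc) (V₁ V₂ : LocalAlg K) :
    braidingOp ρ₁ ρ₂ K V₁ V₂ =
      star ((V₂ : Fock →L[ℂ] Fock) * ρ₂.toFun K V₁) * (V₁ * ρ₁.toFun K V₂) := by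
  rw [braidingOp, star_mul, map_star]
  simp only [mul_assoc]

/-- Changing `W₁`, `W₂` to `U₁ W₁`, `U₂ W₂` does not change the braiding if the unitaries `U₁`, `U₂`
commute with each other and are not affected by the transported charges. -/
theorem braidingOp_mul {ρ₁ ρ₂ τ₁ τ₂ : NetRep} {K : Arc} {U₁ U₂ W₁ W₂ : LocalAlg K}
    (hU₁ : (U₁ : Fock →L[ℂ] Fock) ∈ unitary (Fock →L[ℂ] Fock))
    (hU₂ : (U₂ : Fock →L[ℂ] Fock) ∈ unitary (Fock →L[ℂ] Fock))
    (hU : (U₁ : Fock →L[ℂ] Fock) * U₂ = U₂ * U₁)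
    (hW₁ : ∀ x : LocalAlg K, (W₁ : Fock →L[ℂ] Fock) * ρ₁.toFun K x = τ₁.toFun K x * W₁)
    (hW₂ : ∀ x : LocalAlg K, (W₂ : Fock →L[ℂ] Fock) * ρ₂.toFun K x = τ₂.toFun K x * W₂)
    (hτ₁ : τ₁.toFun K U₂ = U₂) (hτ₂ : τ₂.toFun K U₁ = U₁) :
    braidingOp ρ₁ ρ₂ K (U₁ * W₁) (U₂ * W₂) = braidingOp ρ₁ ρ₂ K W₁ W₂ := by
  have h1 : ((U₁ * W₁ : LocalAlg K) : Fock →L[ℂ] Fock) * ρ₁.toFun K (U₂ * W₂) =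
      (U₂ * U₁) * (W₁ * ρ₁.toFun K W₂) := by
    rw [map_mul, ← hU]
    calc ((U₁ * W₁ : LocalAlg K) : Fock →L[ℂ] Fock) * (ρ₁.toFun K U₂ * ρ₁.toFun K W₂)
        = U₁ * (W₁ * ρ₁.toFun K U₂) * ρ₁.toFun K W₂ := by
          simp only [MulMemClass.coe_mul, mul_assoc]
      _ = _ := by rw [hW₁, hτ₁]; simp only [mul_assoc]
  have h2 : ((U₂ * W₂ : LocalAlg K) : Fock →L[ℂ] Fock) * ρ₂.toFun K (U₁ * W₁) =
      (U₂ * U₁) * (W₂ * ρ₂.toFun K W₁) := by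
    rw [map_mul]
    calc ((U₂ * W₂ : LocalAlg K) : Fock →L[ℂ] Fock) * (ρ₂.toFun K U₁ * ρ₂.toFun K W₁)
        = U₂ * (W₂ * ρ₂.toFun K U₁) * ρ₂.toFun K W₁ := by
          simp only [MulMemClass.coe_mul, mul_assoc]
      _ = _ := by rw [hW₂, hτ₂]; simp only [mul_assoc]
  have h3 := (mul_mem hU₂ hU₁).1
  rw [braidingOp_eq, braidingOp_eq, h1, h2, star_mul, mul_assoc, ← mul_assoc (star _) (_ * _),
    h3, one_mul]

theorem braidingOp_weyl {g₁ g₂ F₁ F₂ : TestFun} {K : Arc} (hF₁ : SuppIn F₁ K)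
    (hF₂ : SuppIn F₂ K) :
    braidingOp (sigma g₁) (sigma g₂) K ⟨weyl F₁, weyl_mem hF₁⟩ ⟨weyl F₂, weyl_mem hF₂⟩ =
      Complex.exp (I * (((∫ t in (0 : ℝ)..(2 * Real.pi), F₂.1 t * g₁.1 t) -
        (∫ t in (0 : ℝ)..(2 * Real.pi), F₁.1 t * g₂.1 t) +
        ∫ t in (0 : ℝ)..(2 * Real.pi), F₂.1 t * deriv F₁.1 t : ℝ) : ℂ)) •
        (1 : Fock →L[ℂ] Fock) := by
  have hcomm : weyl F₁ * weyl F₂ = Complex.exp (I * ((∫ t in (0 : ℝ)..(2 * Real.pi),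
      F₂.1 t * deriv F₁.1 t : ℝ) : ℂ)) • (weyl F₂ * weyl F₁) := by
    rw [← smul_mul_assoc, ← weyl_conj, mul_assoc, star_weyl_mul, mul_one]
  have hone : star (weyl F₂ * weyl F₁) * (weyl F₂ * weyl F₁) = 1 :=
    ((unitary (Fock →L[ℂ] Fock)).mul_mem ⟨star_weyl_mul F₂, weyl_mul_star F₂⟩
      ⟨star_weyl_mul F₁, weyl_mul_star F₁⟩).1
  rw [braidingOp_eq, sigma_weyl g₂ K F₁ hF₁, sigma_weyl g₁ K F₂ hF₂, mul_smul_comm, mul_smul_comm,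
    hcomm, star_smul, star_exp_I_mul_ofReal, smul_mul_assoc, mul_smul_comm, mul_smul_comm, hone,
    smul_smul, smul_smul, ← Complex.exp_add, ← Complex.exp_add]
  congr 2
  push_cast
  ring

/-- All choices of charge transporters give the braiding computed from the Weyl operators `W(F₁)`,
`W(F₂)` which transport `σ_{g₁}`, `σ_{g₂}` to `σ_{k₁}`, `σ_{k₂}`. -/
theorem isDHRBraiding_sigma_iff {g₁ g₂ k₁ k₂ F₁ F₂ : TestFun} {I₀ I₁ I₂ K : Arc}
    (hI : IsConfiguration I₀ I₁ I₂ K) (hg₁ : SuppIn g₁ I₀) (hg₂ : SuppIn g₂ I₀)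
    (hk₁ : SuppIn k₁ I₁) (hk₂ : SuppIn k₂ I₂) (hF₁K : SuppIn F₁ K) (hF₂K : SuppIn F₂ K)
    (hF₁ : ∀ t, deriv F₁.1 t = (k₁ - g₁).1 t) (hF₂ : ∀ t, deriv F₂.1 t = (k₂ - g₂).1 t)
    (ε : Fock →L[ℂ] Fock) :
    IsDHRBraiding (sigma g₁) (sigma g₂) I₀ I₁ I₂ K ε ↔
      ε = braidingOp (sigma g₁) (sigma g₂) K ⟨weyl F₁, weyl_mem hF₁K⟩ ⟨weyl F₂, weyl_mem hF₂K⟩ := by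
  have hW₁ := isChargeTransporter_weyl hg₁ hk₁ hF₁
  have hW₂ := isChargeTransporter_weyl hg₂ hk₂ hF₂
  constructor
  · rintro ⟨τ₁, τ₂, V₁, V₂, hτ₁, hτ₂, hV₁, hV₂, rfl⟩
    set W₁ : LocalAlg K := ⟨weyl F₁, weyl_mem hF₁K⟩
    set W₂ : LocalAlg K := ⟨weyl F₂, weyl_mem hF₂K⟩
    have hc₁ := hV₁.commute_mul_star hW₁ hτ₁ (sigma_isLocalizedIn hk₁)
    have hc₂ := hV₂.commute_mul_star hW₂ hτ₂ (sigma_isLocalizedIn hk₂)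
    -- `I₁.compl` is an interval which contains both `I₀` and `I₂`
    have hmem : (V₂ : Fock →L[ℂ] Fock) * star (weyl F₂) ∈ (localAlg I₁.compl).toStarSubalgebra := by
      have h0 := Arc.subset_compl_of_disjoint hI.disjoint₁.symm
      have h2 := Arc.subset_compl_of_disjoint hI.disjoint₁₂
      have hV := hV₂.mem I₁.compl h0 h2
      have hW := hW₂.mem I₁.compl h0 h2
      exact mul_mem (S := StarSubalgebra ℂ (Fock →L[ℂ] Fock)) hV
        (star_mem (S := StarSubalgebra ℂ (Fock →L[ℂ] Fock)) hW)
    have e₁ : V₁ = (V₁ * star W₁) * W₁ := by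
      ext1
      show (V₁ : Fock →L[ℂ] Fock) = V₁ * star (weyl F₁) * weyl F₁
      rw [mul_assoc, star_weyl_mul, mul_one]
    have e₂ : V₂ = (V₂ * star W₂) * W₂ := by
      ext1
      show (V₂ : Fock →L[ℂ] Fock) = V₂ * star (weyl F₂) * weyl F₂
      rw [mul_assoc, star_weyl_mul, mul_one]
    rw [e₁, e₂]
    exact braidingOp_mul (τ₁ := sigma k₁) (τ₂ := sigma k₂)
      (mul_mem hV₁.unitary (Unitary.star_mem hW₁.unitary))
      (mul_mem hV₂.unitary (Unitary.star_mem hW₂.unitary))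
      (hc₁ ⟨_, hmem⟩) (hW₁.intertwines K) (hW₂.intertwines K)
      (sigma_apply_eq_self hk₁ hI.subset₂ hI.disjoint₁₂ hc₂)
      (sigma_apply_eq_self hk₂ hI.subset₁ hI.disjoint₁₂.symm hc₁)
  · rintro rfl
    exact ⟨sigma k₁, sigma k₂, _, _, sigma_isLocalizedIn hk₁, sigma_isLocalizedIn hk₂, hW₁, hW₂, rfl⟩

/-! ### The phase -/

/-- If the primitive of `k₂` from the left end of `K` takes the constant value `c` on `I₁`, the phase
of the braiding is `q₁ (c - q₂ / 2)`. Apart from `c`, it is the increment over a full turn of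
an antiderivative built from the primitives of `k₁` and `h`; the location of `h` in `K` does not
matter. -/
theorem integral_phase {h k₁ k₂ F₁ F₂ : TestFun} {I₁ K : Arc} {q₁ q₂ c : ℝ}
    (h_int : ∫ t in (0 : ℝ)..(2 * Real.pi), h.1 t = 1) (h₁ : I₁.carrier ⊆ K.carrier)
    (hk₁ : SuppIn k₁ I₁) (hq₁ : ∫ t in (0 : ℝ)..(2 * Real.pi), k₁.1 t = q₁)
    (hF₁K : SuppIn F₁ K) (hF₂K : SuppIn F₂ K)
    (hF₁ : ∀ t, deriv F₁.1 t = (k₁ - q₁ • h).1 t) (hF₂ : ∀ t, deriv F₂.1 t = (k₂ - q₂ • h).1 t)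
    (hc : ∀ t ∈ Set.Ioo K.a K.b, t ∈ I₁.carrier → ∫ s in K.a..t, k₂.1 s = c) :
    (∫ t in (0 : ℝ)..(2 * Real.pi), F₂.1 t * (q₁ • h).1 t) -
        (∫ t in (0 : ℝ)..(2 * Real.pi), F₁.1 t * (q₂ • h).1 t) +
        ∫ t in (0 : ℝ)..(2 * Real.pi), F₂.1 t * deriv F₁.1 t = q₁ * (c - q₂ / 2) := by
  have hFi : ∀ {F k : TestFun} {q : ℝ}, SuppIn F K → (∀ t, deriv F.1 t = (k - q • h).1 t) →
      ∀ t, F.1 t = (∫ s in K.a..t, k.1 s) - q * ∫ s in K.a..t, h.1 s := by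
    intro F k q hFK hF t
    have h0 : F.1 K.a = 0 := hFK.eq_zero fun hK =>
      lt_irrefl _ (Arc.mem_Ioo_of_mem_carrier ⟨le_rfl, by linarith [Real.pi_pos]⟩ hK).1
    have h1 := intervalIntegral.integral_eq_sub_of_hasDerivAt
      (fun s _ => F.hasDerivAt s) (F.deriv.continuous.intervalIntegrable K.a t)
    rw [h0, sub_zero] at h1
    simp only [hF] at h1
    rw [← h1, integral_sub_testFun, integral_smul_testFun]
  set E : TestFun := ⟨fun t => F₂.1 t * k₁.1 t - F₁.1 t * (q₂ • h).1 t,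
    (F₂.2.1.mul k₁.2.1).sub (F₁.2.1.mul (q₂ • h).2.1),
    (F₂.2.2.mul k₁.2.2).sub (F₁.2.2.mul (q₂ • h).2.2)⟩ with hE
  have hcont₁ := F₁.continuous
  have hcont₂ := F₂.continuous
  have hconth := h.continuous
  have hcontk := k₁.continuous
  have hsum : (∫ t in (0 : ℝ)..(2 * Real.pi), F₂.1 t * (q₁ • h).1 t) -
        (∫ t in (0 : ℝ)..(2 * Real.pi), F₁.1 t * (q₂ • h).1 t) +
        (∫ t in (0 : ℝ)..(2 * Real.pi), F₂.1 t * deriv F₁.1 t) =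
      ∫ t in (0 : ℝ)..(2 * Real.pi), E.1 t := by
    have hq : ∀ (q : ℝ) t, (q • h).1 t = q * h.1 t := fun _ _ => rfl
    have hs : ∀ t, (k₁ - q₁ • h).1 t = k₁.1 t - q₁ * h.1 t := fun _ => rfl
    simp only [hF₁, hs, hq, hE]
    rw [← intervalIntegral.integral_sub, ← intervalIntegral.integral_add]
    · congr 1
      funext t
      ring
    all_goals exact Continuous.intervalIntegrable (by fun_prop) _ _
  rw [hsum, ← E.integral_period K.a]
  have hdA := k₁.hasDerivAt_integral K.a
  have hdH := h.hasDerivAt_integral K.a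
  have hd : ∀ t ∈ Set.uIcc K.a (K.a + 2 * Real.pi), HasDerivAt
      (fun t => -q₂ * ((∫ s in K.a..t, h.1 s) * ∫ s in K.a..t, k₁.1 s) +
        q₁ * q₂ / 2 * (∫ s in K.a..t, h.1 s) ^ 2 + c * ∫ s in K.a..t, k₁.1 s) (E.1 t) t := by
    intro t ht
    rw [Set.uIcc_of_le (by linarith [Real.pi_pos])] at ht
    refine HasDerivAt.congr_deriv (((((hdH t).mul (hdA t)).const_mul (-q₂)).add
      (((hdH t).pow 2).const_mul (q₁ * q₂ / 2))).add ((hdA t).const_mul c)) ?_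
    have hck : (∫ s in K.a..t, k₂.1 s) * k₁.1 t = c * k₁.1 t := by
      by_cases htI : t ∈ I₁.carrier
      · rw [hc t (Arc.mem_Ioo_of_mem_carrier ht (h₁ htI)) htI]
      · rw [hk₁.eq_zero htI, mul_zero, mul_zero]
    show _ = F₂.1 t * k₁.1 t - F₁.1 t * (q₂ * h.1 t)
    rw [hFi hF₁K hF₁ t, hFi hF₂K hF₂ t]
    linear_combination -hck
  rw [intervalIntegral.integral_eq_sub_of_hasDerivAt hd (E.continuous.intervalIntegrable _ _),
    h.integral_period, k₁.integral_period, h_int, hq₁]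
  simp only [intervalIntegral.integral_same]
  ring

/-- If `I₂` lies before `I₁`, the primitive of a function supported in `I₂` has reached its full
charge on `I₁`. -/
theorem integral_eq_of_precedes {k : TestFun} {I₁ I₂ K : Arc} (hk : SuppIn k I₂)
    (h₂ : I₂.carrier ⊆ K.carrier) (hK : Precedes K I₂ I₁) :
    ∀ t ∈ Set.Ioo K.a K.b, t ∈ I₁.carrier →
      ∫ s in K.a..t, k.1 s = ∫ s in (0 : ℝ)..(2 * Real.pi), k.1 s := by
  intro t ht htI
  have hi : ∀ x y, IntervalIntegrable k.1 MeasureTheory.volume x y :=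
    fun x y => k.continuous.intervalIntegrable _ _
  have hle : t ≤ K.a + 2 * Real.pi := by linarith [ht.2, K.b_lt]
  have h0 : ∫ s in t..(K.a + 2 * Real.pi), k.1 s = 0 := by
    refine intervalIntegral.integral_zero_ae (Filter.Eventually.of_forall fun s hs => ?_)
    rw [Set.uIoc_of_le hle] at hs
    refine hk.eq_zero fun hsI => ?_
    have hsK := Arc.mem_Ioo_of_mem_carrier ⟨(ht.1.trans hs.1).le, hs.2⟩ (h₂ hsI)
    exact lt_asymm hs.1 (hK s hsK t ht hsI htI)
  rw [← k.integral_period K.a, ← intervalIntegral.integral_add_adjacent_intervals (hi K.a t)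
    (hi t (K.a + 2 * Real.pi)), h0, add_zero]

theorem integral_eq_zero_of_precedes {k : TestFun} {I₁ I₂ K : Arc} (hk : SuppIn k I₂)
    (hK : Precedes K I₁ I₂) :
    ∀ t ∈ Set.Ioo K.a K.b, t ∈ I₁.carrier → ∫ s in K.a..t, k.1 s = 0 := by
  intro t ht htI
  refine intervalIntegral.integral_zero_ae (Filter.Eventually.of_forall fun s hs => ?_)
  rw [Set.uIoc_of_le ht.1.le] at hs
  refine hk.eq_zero fun hsI => ?_
  have hsK : s ∈ Set.Ioo K.a K.b := ⟨hs.1, hs.2.trans_lt ht.2⟩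
  exact absurd (hK t ht s hsK htI hsI) (not_lt.2 hs.2)

/-- The braiding of `σ_{q₁ h}` and `σ_{q₂ h}` is the phase `exp (i q₁ (c - q₂ / 2))`, where `c` is the
part of a charge `q₂` located in `I₂` which lies before `I₁`. -/
theorem isDHRBraiding_smul_iff {h : TestFun} {I₀ I₁ I₂ K : Arc} (hh : SuppIn h I₀)
    (h_int : ∫ t in (0 : ℝ)..(2 * Real.pi), h.1 t = 1) (hI : IsConfiguration I₀ I₁ I₂ K)
    {q₁ q₂ c : ℝ}
    (hc : ∀ k : TestFun, SuppIn k I₂ → ∫ t in (0 : ℝ)..(2 * Real.pi), k.1 t = q₂ →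
      ∀ t ∈ Set.Ioo K.a K.b, t ∈ I₁.carrier → ∫ s in K.a..t, k.1 s = c)
    (ε : Fock →L[ℂ] Fock) :
    IsDHRBraiding (sigma (q₁ • h)) (sigma (q₂ • h)) I₀ I₁ I₂ K ε ↔
      ε = Complex.exp (I * ((q₁ * (c - q₂ / 2) : ℝ) : ℂ)) • (1 : Fock →L[ℂ] Fock) := by
  have key : ∀ (J : Arc), J.carrier ⊆ K.carrier → ∀ q : ℝ, ∃ k F : TestFun, SuppIn k J ∧
      ∫ t in (0 : ℝ)..(2 * Real.pi), k.1 t = q ∧ SuppIn F K ∧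
      ∀ t, deriv F.1 t = (k - q • h).1 t := by
    intro J hJ q
    obtain ⟨β, hβ, hβ1⟩ := exists_bump J
    have hq : ∫ t in (0 : ℝ)..(2 * Real.pi), (q • β).1 t = q := by
      rw [integral_smul_testFun, hβ1, mul_one]
    obtain ⟨F, hFK, hF⟩ := exists_suppIn_primitive
      (((hβ.smul q).mono hJ).sub ((hh.smul q).mono hI.subset)) (by
        rw [integral_sub_testFun, integral_smul_testFun, integral_smul_testFun, hβ1, h_int,
          sub_self])
    exact ⟨q • β, F, hβ.smul q, hq, hFK, hF⟩
  obtain ⟨k₁, F₁, hk₁, hq₁, hF₁K, hF₁⟩ := key I₁ hI.subset₁ q₁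
  obtain ⟨k₂, F₂, hk₂, hq₂, hF₂K, hF₂⟩ := key I₂ hI.subset₂ q₂
  rw [isDHRBraiding_sigma_iff hI (hh.smul q₁) (hh.smul q₂) hk₁ hk₂ hF₁K hF₂K hF₁ hF₂,
    braidingOp_weyl hF₁K hF₂K,
    integral_phase h_int hI.subset₁ hk₁ hq₁ hF₁K hF₂K hF₁ hF₂ (hc k₂ hk₂ hq₂)]

theorem isDHRBraiding_chargedAut_iff_of_precedes₂₁ {h : TestFun} {I₀ I₁ I₂ K : Arc}
    (hh : SuppIn h I₀) (h_int : ∫ t in (0 : ℝ)..(2 * Real.pi), h.1 t = 1)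
    (hI : IsConfiguration I₀ I₁ I₂ K) (hK : Precedes K I₂ I₁) (α₁ α₂ : ℝ)
    (ε : Fock →L[ℂ] Fock) :
    IsDHRBraiding (chargedAut h α₁) (chargedAut h α₂) I₀ I₁ I₂ K ε ↔
      ε = Complex.exp (I * Real.pi * α₁ * α₂) • (1 : Fock →L[ℂ] Fock) := by
  rw [chargedAut, chargedAut, isDHRBraiding_smul_iff hh h_int hI
    (fun k hk hq t ht htI => (integral_eq_of_precedes hk hI.subset₂ hK t ht htI).trans hq)]
  have : Real.sqrt (2 * Real.pi) * α₁ * (Real.sqrt (2 * Real.pi) * α₂ -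
      Real.sqrt (2 * Real.pi) * α₂ / 2) = Real.pi * α₁ * α₂ := by
    linear_combination (α₁ * α₂ / 2) * Real.sq_sqrt Real.two_pi_pos.le
  rw [this]
  push_cast
  simp only [mul_assoc]

theorem isDHRBraiding_chargedAut_iff_of_precedes₁₂ {h : TestFun} {I₀ I₁ I₂ K : Arc}
    (hh : SuppIn h I₀) (h_int : ∫ t in (0 : ℝ)..(2 * Real.pi), h.1 t = 1)
    (hI : IsConfiguration I₀ I₁ I₂ K) (hK : Precedes K I₁ I₂) (α₁ α₂ : ℝ)
    (ε : Fock →L[ℂ] Fock) :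
    IsDHRBraiding (chargedAut h α₁) (chargedAut h α₂) I₀ I₁ I₂ K ε ↔
      ε = Complex.exp (-(I * Real.pi * α₁ * α₂)) • (1 : Fock →L[ℂ] Fock) := by
  rw [chargedAut, chargedAut, isDHRBraiding_smul_iff hh h_int hI
    (fun k hk _ => integral_eq_zero_of_precedes hk hK)]
  have : Real.sqrt (2 * Real.pi) * α₁ * (0 - Real.sqrt (2 * Real.pi) * α₂ / 2) =
      -(Real.pi * α₁ * α₂) := by
    linear_combination (-α₁ * α₂ / 2) * Real.sq_sqrt Real.two_pi_pos.le
  rw [this]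
  push_cast
  simp only [mul_assoc, mul_neg]

end U1Current

open U1Current in
theorem mainTheorem8 (I : Arc) (h : TestFun) (h_supp : SuppIn h I)
    (h_int : ∫ t in (0 : ℝ)..(2 * Real.pi), h.1 t = 1) :
    (∀ α : ℝ, (chargedAut h α).IsAutomorphism ∧ (chargedAut h α).IsLocalizedIn I ∧
      ∀ (J : Arc) (f : TestFun) (hf : SuppIn f J),
        (chargedAut h α).toFun J ⟨weyl f, weyl_mem hf⟩ =
          Complex.exp (Complex.I * Real.sqrt (2 * Real.pi) * α *
            ((∫ t in (0 : ℝ)..(2 * Real.pi), f.1 t * h.1 t : ℝ) : ℂ)) • weyl f) ∧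
    ∀ (α₁ α₂ : ℝ) (I₁ I₂ K : Arc), IsConfiguration I I₁ I₂ K →
      (Precedes K I₂ I₁ → ∀ ε : Fock →L[ℂ] Fock,
        IsDHRBraiding (chargedAut h α₁) (chargedAut h α₂) I I₁ I₂ K ε ↔
          ε = Complex.exp (Complex.I * Real.pi * α₁ * α₂) • (1 : Fock →L[ℂ] Fock)) ∧
      (Precedes K I₁ I₂ → ∀ ε : Fock →L[ℂ] Fock,
        IsDHRBraiding (chargedAut h α₁) (chargedAut h α₂) I I₁ I₂ K ε ↔
          ε = Complex.exp (-(Complex.I * Real.pi * α₁ * α₂)) • (1 : Fock →L[ℂ] Fock)) ∧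
      ∀ ε : Fock →L[ℂ] Fock,
        IsDHRBraiding (chargedAut h α₁) (chargedAut h α₂) I I₁ I₂ K ε ↔
          IsDHRBraiding (chargedAut h α₂) (chargedAut h α₁) I I₁ I₂ K ε := by
  refine ⟨fun α => ⟨sigma_isAutomorphism _, sigma_isLocalizedIn (h_supp.smul _), ?_⟩, ?_⟩
  · intro J f hf
    rw [chargedAut, sigma_weyl _ J f hf]
    have hq : ∀ t, f.1 t * ((Real.sqrt (2 * Real.pi) * α) • h).1 t =
        Real.sqrt (2 * Real.pi) * α * (f.1 t * h.1 t) := by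
      intro t
      show f.1 t * (Real.sqrt (2 * Real.pi) * α * h.1 t) = _
      ring
    simp only [hq, intervalIntegral.integral_const_mul]
    push_cast
    simp only [mul_assoc]
  · intro α₁ α₂ I₁ I₂ K hI
    refine ⟨fun hK => isDHRBraiding_chargedAut_iff_of_precedes₂₁ h_supp h_int hI hK α₁ α₂,
      fun hK => isDHRBraiding_chargedAut_iff_of_precedes₁₂ h_supp h_int hI hK α₁ α₂, fun ε => ?_⟩
    rcases precedes_or_precedes hI.subset₁ hI.subset₂ hI.disjoint₁₂ with hK | hK
    · rw [isDHRBraiding_chargedAut_iff_of_precedes₂₁ h_supp h_int hI hK,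
        isDHRBraiding_chargedAut_iff_of_precedes₂₁ h_supp h_int hI hK, mul_right_comm]
    · rw [isDHRBraiding_chargedAut_iff_of_precedes₁₂ h_supp h_int hI hK,
        isDHRBraiding_chargedAut_iff_of_precedes₁₂ h_supp h_int hI hK, mul_right_comm]
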